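/- Let $\mathsf C$ be a symmetric monoidal category with tensor product $\otimes$, unit object $K$ and symmetry $c$ ($\mathsf C$ need not be strict; associativity and unit constraints are suppressed in the notation). An object also denotes its identity morphism. If $D,E$ are comonoids, $D\otimes E$ carries the tensor product comonoid structure $\varepsilon_{D\otimes E}=\varepsilon_D\otimes\varepsilon_E$, $\delta_{D\otimes E}=(D\otimes c_{D,E}\otimes E)\circ(\delta_D\otimes\delta_E)$. **Hopf quasigroups.** A Hopf quasigroup $H$ in $\mathsf C$ is an object $H$ with a comonoid structure $(\varepsilon_H,\delta_H)$ (counital and coassociative), a unit $\eta_H:K\to H$, a product $\mu_H:H\otimes H\to H$ with two-sided unit $\eta_H$ (not necessarily associative), such that $\varepsilon_H\circ\eta_H=\mathrm{id}_K$, $\varepsilon_H\circ\mu_H=\varepsilon_H\otimes\varepsilon_H$, $\delta_H\circ\eta_H=\eta_H\otimes\eta_H$, $\delta_H\circ\mu_H=(\mu_H\otimes\mu_H)\circ\delta_{H\otimes H}$, and a morphism $\lambda_H:H\to H$ (the antipode) with $$\mu_H\circ(\lambda_H\otimes\mu_H)\circ(\delta_H\otimes H)=\varepsilon_H\otimes H=\mu_H\circ(H\otimes\mu_H)\circ(H\otimes\lambda_H\otimes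 H)\circ(\delta_H\otimes H),$$ $$\mu_H\circ(\mu_H\otimes H)\circ(H\otimes\lambda_H\otimes H)\circ(H\otimes\delta_H)=H\otimes\varepsilon_H=\mu_H\circ(\mu_H\otimes\lambda_H)\circ(H\otimes\delta_H).$$ A morphism of Hopf quasigroups is a morphism in $\mathsf C$ compatible with units, products, counits and coproducts. **Factorization.** Let $H,A,X$ be Hopf quasigroups. One says that $X$ factorizes as $X=AH$ if there are morphisms of Hopf quasigroups $i_A:A\to X$ and $i_H:H\to X$, both monomorphisms in $\mathsf C$, such that, with $\omega_X=\mu_X\circ(i_A\otimes i_H):A\otimes H\to X$ and $\theta_X=\mu_X\circ(i_H\otimes i_A):H\otimes A\to X$, the morphism $\omega_X$ is an isomorphism and $$\mu_X\circ(\omega_X\otimes X)=\mu_X\circ(i_A\otimes(\mu_X\circ(i_H\otimes X))),$$ $$\mu_X\circ(X\otimes\omega_X)=\mu_X\circ((\mu_X\circ(X\otimes i_A))\otimes i_H),$$ $$\mu_X\circ((\theta_X\circ(\lambda_H\otimes\lambda_A))\otimes X)=\mu_X\circ((i_H\circ\lambda_H)\otimes(\mu_X\circ((i_A\circ\lambda_A)\otimes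 X))),$$ $$\mu_X\circ(X\otimes(\theta_X\circ(\lambda_H\otimes\lambda_A)))=\mu_X\circ((\mu_X\circ(X\otimes(i_H\circ\lambda_H)))\otimes(i_A\circ\lambda_A)).$$ **Matched pairs.** A matched pair of Hopf quasigroups $(A,H)$ consists of comonoid morphisms $\varphi_A:H\otimes A\to A$ and $\phi_H:H\otimes A\to H$ that are actions, i.e. $\varphi_A\circ(\eta_H\otimes A)=A$, $\varphi_A\circ(H\otimes\varphi_A)=\varphi_A\circ(\mu_H\otimes A)$, $\phi_H\circ(H\otimes\eta_A)=H$, $\phi_H\circ(\phi_H\otimes A)=\phi_H\circ(H\otimes\mu_A)$, and that satisfy, with $\Psi=(\varphi_A\otimes\phi_H)\circ\delta_{H\otimes A}:H\otimes A\to A\otimes H$, $$\varphi_A\circ(H\otimes\eta_A)=\varepsilon_H\otimes\eta_A,\qquad \phi_H\circ(\eta_H\otimes A)=\eta_H\otimes\varepsilon_A,\qquad (\phi_H\otimes\varphi_A)\circ\delta_{H\otimes A}=c_{A,H}\circ\Psi,$$ $$\varphi_A\circ(H\otimes\mu_A)\circ(\lambda_H\otimes\lambda_A\otimes A)=\mu_A\circ(A\otimes\varphi_A)\circ((\Psi\circ(\lambda_H\otimes\lambda_A))\otimes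 A),$$ $$\mu_H\circ(\phi_H\otimes\mu_H)\circ(\lambda_H\otimes\Psi\otimes H)\circ(\delta_H\otimes A\otimes H)=\varepsilon_H\otimes\varepsilon_A\otimes H,$$ $$\mu_H\circ(\phi_H\otimes\mu_H)\circ(H\otimes\Psi\otimes H)\circ(((H\otimes\lambda_H)\circ\delta_H)\otimes A\otimes H)=\varepsilon_H\otimes\varepsilon_A\otimes H,$$ $$\phi_H\circ(\mu_H\otimes A)\circ(H\otimes\lambda_H\otimes\lambda_A)=\mu_H\circ(\phi_H\otimes H)\circ(H\otimes(\Psi\circ(\lambda_H\otimes\lambda_A))),$$ $$\mu_A\circ(\mu_A\otimes\varphi_A)\circ(A\otimes\Psi\otimes\lambda_A)\circ(A\otimes H\otimes\delta_A)=A\otimes\varepsilon_H\otimes\varepsilon_A,$$ $$\mu_A\circ(\mu_A\otimes\varphi_A)\circ(A\otimes\Psi\otimes A)\circ(A\otimes H\otimes((\lambda_A\otimes A)\circ\delta_A))=A\otimes\varepsilon_H\otimes\varepsilon_A.$$ The double cross product $A\bowtie H$ of a matched pair is the tensor product comonoid $A\otimes H$ with unit $\eta_A\otimes\eta_H$, product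 $\mu_{A\bowtie H}=(\mu_A\otimes\mu_H)\circ(A\otimes\Psi\otimes H)$ and antipode $\lambda_{A\bowtie H}=\Psi\circ(\lambda_H\otimes\lambda_A)\circ c_{A,H}$. **Theorem.** Let $H,A,X$ be Hopf quasigroups in $\mathsf C$ such that $\lambda_H$ and $\lambda_A$ are isomorphisms. Then for every matched pair of Hopf quasigroups $(A,H)$ the double cross product $A\bowtie H$ is a Hopf quasigroup, and $X$ factorizes as $X=AH$ if and only if there exists a matched pair of Hopf quasigroups $(A,H)$ such that $X$ is isomorphic to $A\bowtie H$ as Hopf quasigroups. -/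

import Mathlib

open CategoryTheory MonoidalCategory ComonObj

universe v u

/- Throughout, `C` is a symmetric monoidal category which need not be strict: the associators `α_`,
the unitors `λ_`, `ρ_` are written out, the symmetry is `β_`. Composition is in diagrammatic order.
For comonoids `D`, `E`, Mathlib's comonoid structure on `D ⊗ E` is the tensor product comonoid:
`Δ[D ⊗ E] = (Δ[D] ⊗ₘ Δ[E]) ≫ (middle symmetry)` and `ε[D ⊗ E] = ε[D] ⊗ ε[E]`. -/

/-- A comonoid `X` in `C` together with morphisms: a unit, a product and a candidate antipode.
These are only the structure morphisms; the laws are in `HopfQuasigroupData.IsHopfQuasigroup`. -/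
structure HopfQuasigroupData (C : Type u) [Category.{v} C] [MonoidalCategory C] where
  /-- the underlying object -/
  X : C
  /-- the comonoid structure -/
  [comon : ComonObj X]
  /-- the unit -/
  one : 𝟙_ C ⟶ X
  /-- the (not necessarily associative) product -/
  mul : X ⊗ X ⟶ X
  /-- the antipode -/
  antipode : X ⟶ X

attribute [instance] HopfQuasigroupData.comon

namespace HopfQuasigroupData

/-- `Q` is a Hopf quasigroup: a non-associative bimonoid (a unital magma and a comonoid such that
the counit and the coproduct are morphisms of unital magmas) with an antipode. -/
structure IsHopfQuasigroup {C : Type u} [Category.{v} C] [MonoidalCategory C]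
    [SymmetricCategory C] (Q : HopfQuasigroupData C) : Prop where
  one_mul : Q.one ▷ Q.X ≫ Q.mul = (λ_ Q.X).hom
  mul_one : Q.X ◁ Q.one ≫ Q.mul = (ρ_ Q.X).hom
  one_counit : Q.one ≫ ε[Q.X] = 𝟙 (𝟙_ C)
  mul_counit : Q.mul ≫ ε[Q.X] = ε[Q.X ⊗ Q.X]
  one_comul : Q.one ≫ Δ[Q.X] = (λ_ (𝟙_ C)).inv ≫ (Q.one ⊗ₘ Q.one)
  mul_comul : Q.mul ≫ Δ[Q.X] = Δ[Q.X ⊗ Q.X] ≫ (Q.mul ⊗ₘ Q.mul)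
  /-- `S(h₁)(h₂ g) = ε(h) g` -/
  antipode_mul_mul :
    Δ[Q.X] ▷ Q.X ≫ (α_ Q.X Q.X Q.X).hom ≫ (Q.antipode ⊗ₘ Q.mul) ≫ Q.mul =
      ε[Q.X] ▷ Q.X ≫ (λ_ Q.X).hom
  /-- `h₁(S(h₂) g) = ε(h) g` -/
  mul_antipode_mul :
    Δ[Q.X] ▷ Q.X ≫ (α_ Q.X Q.X Q.X).hom ≫ Q.X ◁ Q.antipode ▷ Q.X ≫ Q.X ◁ Q.mul ≫ Q.mul =
      ε[Q.X] ▷ Q.X ≫ (λ_ Q.X).hom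
  /-- `(h S(g₁)) g₂ = h ε(g)` -/
  mul_antipode_mul' :
    Q.X ◁ Δ[Q.X] ≫ (α_ Q.X Q.X Q.X).inv ≫ (Q.X ◁ Q.antipode) ▷ Q.X ≫ Q.mul ▷ Q.X ≫ Q.mul =
      Q.X ◁ ε[Q.X] ≫ (ρ_ Q.X).hom
  /-- `(h g₁) S(g₂) = h ε(g)` -/
  mul_mul_antipode :
    Q.X ◁ Δ[Q.X] ≫ (α_ Q.X Q.X Q.X).inv ≫ (Q.mul ⊗ₘ Q.antipode) ≫ Q.mul =
      Q.X ◁ ε[Q.X] ≫ (ρ_ Q.X).hom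

/-- A morphism of unital magmas and comonoids. Between Hopf quasigroups these are the morphisms of
Hopf quasigroups (compatibility with the antipodes is then automatic). -/
structure IsHom {C : Type u} [Category.{v} C] [MonoidalCategory C]
    {P Q : HopfQuasigroupData C} (f : P.X ⟶ Q.X) : Prop where
  map_one : P.one ≫ f = Q.one
  map_mul : P.mul ≫ f = (f ⊗ₘ f) ≫ Q.mul
  map_counit : f ≫ ε[Q.X] = ε[P.X]
  map_comul : f ≫ Δ[Q.X] = Δ[P.X] ≫ (f ⊗ₘ f)

end HopfQuasigroupData

/-- A Hopf quasigroup in a symmetric monoidal category. -/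
structure HopfQuasigroup (C : Type u) [Category.{v} C] [MonoidalCategory C]
    [SymmetricCategory C] extends HopfQuasigroupData C where
  isHopfQuasigroup : toHopfQuasigroupData.IsHopfQuasigroup

/-- For `φ : H ⊗ A ⟶ A` and `φ' : H ⊗ A ⟶ H`, the morphism
`Ψ = (φ ⊗ φ') ∘ δ_{H ⊗ A} : H ⊗ A ⟶ A ⊗ H`. -/
def crossing {C : Type u} [Category.{v} C] [MonoidalCategory C] [SymmetricCategory C]
    {A H : C} [ComonObj A] [ComonObj H] (φ : H ⊗ A ⟶ A) (φ' : H ⊗ A ⟶ H) : H ⊗ A ⟶ A ⊗ H :=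
  Δ[H ⊗ A] ≫ (φ ⊗ₘ φ')

/-- A matched pair of Hopf quasigroups `(A, H)`: `A` is a left `H`-module comonoid, `H` is a right
`A`-module comonoid, and the compatibility conditions below hold. In the comments `h ▷ a`, `h ◁ a`
are the two actions, `S` the antipodes, and `Ψ(h ⊗ a) = (h₁ ▷ a₁) ⊗ (h₂ ◁ a₂)` is written
`Ψ(h ⊗ a)' ⊗ Ψ(h ⊗ a)''`. -/
structure MatchedPair {C : Type u} [Category.{v} C] [MonoidalCategory C] [SymmetricCategory C]
    (A H : HopfQuasigroup C) where
  /-- the left action `h ⊗ a ↦ h ▷ a` -/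
  actL : H.X ⊗ A.X ⟶ A.X
  /-- the right action `h ⊗ a ↦ h ◁ a` -/
  actR : H.X ⊗ A.X ⟶ H.X
  /-- `1 ▷ a = a` -/
  one_actL : H.one ▷ A.X ≫ actL = (λ_ A.X).hom
  /-- `h ▷ (g ▷ a) = (h g) ▷ a` -/
  mul_actL : H.X ◁ actL ≫ actL = (α_ H.X H.X A.X).inv ≫ H.mul ▷ A.X ≫ actL
  /-- `ε(h ▷ a) = ε(h) ε(a)` -/
  actL_counit : actL ≫ ε[A.X] = ε[H.X ⊗ A.X]
  /-- `δ(h ▷ a) = (h₁ ▷ a₁) ⊗ (h₂ ▷ a₂)` -/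
  actL_comul : actL ≫ Δ[A.X] = Δ[H.X ⊗ A.X] ≫ (actL ⊗ₘ actL)
  /-- `h ◁ 1 = h` -/
  actR_one : H.X ◁ A.one ≫ actR = (ρ_ H.X).hom
  /-- `(h ◁ a) ◁ b = h ◁ (a b)` -/
  actR_mul : actR ▷ A.X ≫ actR = (α_ H.X A.X A.X).hom ≫ H.X ◁ A.mul ≫ actR
  /-- `ε(h ◁ a) = ε(h) ε(a)` -/
  actR_counit : actR ≫ ε[H.X] = ε[H.X ⊗ A.X]
  /-- `δ(h ◁ a) = (h₁ ◁ a₁) ⊗ (h₂ ◁ a₂)` -/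
  actR_comul : actR ≫ Δ[H.X] = Δ[H.X ⊗ A.X] ≫ (actR ⊗ₘ actR)
  /-- `h ▷ 1 = ε(h) 1` -/
  actL_one : H.X ◁ A.one ≫ actL = (ρ_ H.X).hom ≫ ε[H.X] ≫ A.one
  /-- `1 ◁ a = ε(a) 1` -/
  one_actR : H.one ▷ A.X ≫ actR = (λ_ A.X).hom ≫ ε[A.X] ≫ H.one
  /-- `(h₁ ◁ a₁) ⊗ (h₂ ▷ a₂) = (h₂ ◁ a₂) ⊗ (h₁ ▷ a₁)` -/
  act_comm : Δ[H.X ⊗ A.X] ≫ (actR ⊗ₘ actL) = crossing actL actR ≫ (β_ A.X H.X).hom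
  /-- `S(h) ▷ (S(a) b) = Ψ(S(h) ⊗ S(a))' (Ψ(S(h) ⊗ S(a))'' ▷ b)` -/
  actL_mul :
    (H.antipode ⊗ₘ A.antipode) ▷ A.X ≫ (α_ H.X A.X A.X).hom ≫ H.X ◁ A.mul ≫ actL =
      ((H.antipode ⊗ₘ A.antipode) ≫ crossing actL actR) ▷ A.X ≫
        (α_ A.X H.X A.X).hom ≫ A.X ◁ actL ≫ A.mul
  /-- `(S(h₁) ◁ Ψ(h₂ ⊗ a)') (Ψ(h₂ ⊗ a)'' g) = ε(h) ε(a) g` -/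
  antipode_actR :
    Δ[H.X] ▷ (A.X ⊗ H.X) ≫ (α_ H.X H.X (A.X ⊗ H.X)).hom ≫ H.X ◁ (α_ H.X A.X H.X).inv ≫
      (H.antipode ⊗ₘ (crossing actL actR ▷ H.X)) ≫
      H.X ◁ (α_ A.X H.X H.X).hom ≫ (α_ H.X A.X (H.X ⊗ H.X)).inv ≫ (actR ⊗ₘ H.mul) ≫ H.mul =
    (ε[H.X] ⊗ₘ (ε[A.X] ▷ H.X ≫ (λ_ H.X).hom)) ≫ (λ_ H.X).hom
  /-- `(h₁ ◁ Ψ(S(h₂) ⊗ a)') (Ψ(S(h₂) ⊗ a)'' g) = ε(h) ε(a) g` -/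
  actR_antipode :
    (Δ[H.X] ≫ H.X ◁ H.antipode) ▷ (A.X ⊗ H.X) ≫ (α_ H.X H.X (A.X ⊗ H.X)).hom ≫
      H.X ◁ (α_ H.X A.X H.X).inv ≫ H.X ◁ (crossing actL actR ▷ H.X) ≫
      H.X ◁ (α_ A.X H.X H.X).hom ≫ (α_ H.X A.X (H.X ⊗ H.X)).inv ≫ (actR ⊗ₘ H.mul) ≫ H.mul =
    (ε[H.X] ⊗ₘ (ε[A.X] ▷ H.X ≫ (λ_ H.X).hom)) ≫ (λ_ H.X).hom
  /-- `(h S(g)) ◁ S(a) = (h ◁ Ψ(S(g) ⊗ S(a))') Ψ(S(g) ⊗ S(a))''` -/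
  mul_actR :
    H.X ◁ (H.antipode ⊗ₘ A.antipode) ≫ (α_ H.X H.X A.X).inv ≫ H.mul ▷ A.X ≫ actR =
      H.X ◁ ((H.antipode ⊗ₘ A.antipode) ≫ crossing actL actR) ≫
        (α_ H.X A.X H.X).inv ≫ actR ▷ H.X ≫ H.mul
  /-- `(a Ψ(h ⊗ b₁)') (Ψ(h ⊗ b₁)'' ▷ S(b₂)) = a ε(h) ε(b)` -/
  actL_antipode :
    (A.X ⊗ H.X) ◁ Δ[A.X] ≫ (α_ (A.X ⊗ H.X) A.X A.X).inv ≫ (α_ A.X H.X A.X).hom ▷ A.X ≫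
      ((A.X ◁ crossing actL actR) ⊗ₘ A.antipode) ≫
      (α_ A.X A.X H.X).inv ▷ A.X ≫ (α_ (A.X ⊗ A.X) H.X A.X).hom ≫ (A.mul ⊗ₘ actL) ≫ A.mul =
    ((A.X ◁ ε[H.X] ≫ (ρ_ A.X).hom) ⊗ₘ ε[A.X]) ≫ (ρ_ A.X).hom
  /-- `(a Ψ(h ⊗ S(b₁))') (Ψ(h ⊗ S(b₁))'' ▷ b₂) = a ε(h) ε(b)` -/
  antipode_actL :
    (A.X ⊗ H.X) ◁ (Δ[A.X] ≫ A.antipode ▷ A.X) ≫ (α_ (A.X ⊗ H.X) A.X A.X).inv ≫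
      (α_ A.X H.X A.X).hom ▷ A.X ≫ (A.X ◁ crossing actL actR) ▷ A.X ≫
      (α_ A.X A.X H.X).inv ▷ A.X ≫ (α_ (A.X ⊗ A.X) H.X A.X).hom ≫ (A.mul ⊗ₘ actL) ≫ A.mul =
    ((A.X ◁ ε[H.X] ≫ (ρ_ A.X).hom) ⊗ₘ ε[A.X]) ≫ (ρ_ A.X).hom

/-- The structure morphisms of the double cross product `A ⋈ H` on `A ⊗ H`: tensor product unit,
counit and coproduct, product `(μ_A ⊗ μ_H) ∘ (A ⊗ Ψ ⊗ H)` and antipode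
`Ψ ∘ (S_H ⊗ S_A) ∘ c_{A,H}`. -/
def MatchedPair.doubleCrossProduct {C : Type u} [Category.{v} C] [MonoidalCategory C]
    [SymmetricCategory C] {A H : HopfQuasigroup C} (M : MatchedPair A H) :
    HopfQuasigroupData C where
  X := A.X ⊗ H.X
  one := (λ_ (𝟙_ C)).inv ≫ (A.one ⊗ₘ H.one)
  mul := (α_ A.X H.X (A.X ⊗ H.X)).hom ≫ A.X ◁ (α_ H.X A.X H.X).inv ≫
    A.X ◁ (crossing M.actL M.actR ▷ H.X) ≫ A.X ◁ (α_ A.X H.X H.X).hom ≫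
    (α_ A.X A.X (H.X ⊗ H.X)).inv ≫ (A.mul ⊗ₘ H.mul)
  antipode := (β_ A.X H.X).hom ≫ (H.antipode ⊗ₘ A.antipode) ≫ crossing M.actL M.actR

/-- `iA` and `iH` exhibit `A` and `H` as Hopf subquasigroups of `X` for which `X = AH`. -/
structure IsFactorization {C : Type u} [Category.{v} C] [MonoidalCategory C]
    [SymmetricCategory C] {A H X : HopfQuasigroup C} (iA : A.X ⟶ X.X) (iH : H.X ⟶ X.X) :
    Prop where
  isHom_A : HopfQuasigroupData.IsHom (P := A.toHopfQuasigroupData)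
    (Q := X.toHopfQuasigroupData) iA
  isHom_H : HopfQuasigroupData.IsHom (P := H.toHopfQuasigroupData)
    (Q := X.toHopfQuasigroupData) iH
  mono_A : Mono iA
  mono_H : Mono iH
  /-- `ω : a ⊗ h ↦ a h` is an isomorphism -/
  isIso : IsIso ((iA ⊗ₘ iH) ≫ X.mul)
  /-- `(a h) x = a (h x)` -/
  mul_assoc_left : ((iA ⊗ₘ iH) ≫ X.mul) ▷ X.X ≫ X.mul =
    (α_ A.X H.X X.X).hom ≫ (iA ⊗ₘ (iH ▷ X.X ≫ X.mul)) ≫ X.mul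
  /-- `x (a h) = (x a) h` -/
  mul_assoc_right : X.X ◁ ((iA ⊗ₘ iH) ≫ X.mul) ≫ X.mul =
    (α_ X.X A.X H.X).inv ≫ ((X.X ◁ iA ≫ X.mul) ⊗ₘ iH) ≫ X.mul
  /-- `(S(h) S(a)) x = S(h) (S(a) x)` -/
  antipode_assoc_left :
    ((H.antipode ⊗ₘ A.antipode) ≫ (iH ⊗ₘ iA) ≫ X.mul) ▷ X.X ≫ X.mul =
      (α_ H.X A.X X.X).hom ≫
        ((H.antipode ≫ iH) ⊗ₘ ((A.antipode ≫ iA) ▷ X.X ≫ X.mul)) ≫ X.mul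
  /-- `x (S(h) S(a)) = (x S(h)) S(a)` -/
  antipode_assoc_right :
    X.X ◁ ((H.antipode ⊗ₘ A.antipode) ≫ (iH ⊗ₘ iA) ≫ X.mul) ≫ X.mul =
      (α_ X.X H.X A.X).inv ≫
        ((X.X ◁ (H.antipode ≫ iH) ≫ X.mul) ⊗ₘ (A.antipode ≫ iA)) ≫ X.mul

/-- `X` factorizes as `X = AH`. -/
def Factorizes {C : Type u} [Category.{v} C] [MonoidalCategory C] [SymmetricCategory C]
    (X A H : HopfQuasigroup C) : Prop :=
  ∃ (iA : A.X ⟶ X.X) (iH : H.X ⟶ X.X), IsFactorization iA iH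

/-!
Two ideas carry the proof.

*Generalized elements.* Let `D` be a comonoid. Morphisms `f : D ⟶ Y`, `g : D ⟶ Z` have a pairing
`⟪f, g⟫ = Δ ≫ (f ⊗ g) : D ⟶ Y ⊗ Z`, in Sweedler notation `d ↦ f(d₁) ⊗ g(d₂)`. It is associative up
to the associator, so that a product `⟪f, g⟫ ≫ μ` can be written without constraints. Call a morphism
of comonoids `D ⟶ Y` a point of `Y`. Points can be substituted into pairings (`comp_pair`), and the
two projections of `Y ⊗ Z` are points whose pairing is the identity; hence an identity between
morphisms out of a tensor product of comonoids may be checked on commuting points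
(`hom_ext_pair`). The antipode axioms then read like the cancellation laws of a loop:
`S(h)(h g) = g` and so on, for a point `h` and an arbitrary `g`. Thus no Sweedler index and no
anticomultiplicativity of the antipode is needed below.

*Distributive laws.* A matched pair is the same as a morphism of comonoids
`Ψ : H ⊗ A ⟶ A ⊗ H`, which says how to move `h` past `a`, compatible with the units and the products
of `H` and `A` (`IsDistributiveLaw`); because the antipodes are invertible, they can be
removed from the two axioms of a matched pair that express compatibility with the products
(`MatchedPair.isDistributiveLaw`). A distributive law makes both `A` and `H` operate on `A ⊗ H` from
the left and from the right. The operation of `a` cancels against that of `S(a)`, that of `h` against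
that of `S(h)`, in either order:

* `S(h)(h w) = w`, because `Ψ(S(h) ⊗ (h ▷ a)) = a ⊗ S(h ◁ a)`, see
  `IsDistributiveLaw.pair_antipode_left`;
* `h(S(h) w) = w`, because every `w` has the form `h v`, see
  `IsDistributiveLaw.exists_leftMulH_eq`.

These cancellation laws give the antipode axioms of `A ⋈ H`
(`IsDistributiveLaw.isHopfQuasigroup`), and also those axioms of a matched pair which involve one
antipode (`IsDistributiveLaw.matchedPair`).

It remains to compare with factorizations. The obvious inclusions exhibit `A ⋈ H` as a product of `A`
and `H` (`IsDistributiveLaw.isFactorization`), and factorizations are transported along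
isomorphisms. Conversely, if `X = AH` with `ω(a ⊗ h) = a h` and `θ(h ⊗ a) = h a`, then `θ ≫ ω⁻¹` is a
distributive law (`IsFactorization.isDistributiveLaw`) and `ω` is an isomorphism from `A ⋈ H` to `X`
(`IsFactorization.isHom_prodAH`).
-/

/-! ### Generalized elements over a comonoid -/

section Elements

variable {C : Type u} [Category.{v} C] [MonoidalCategory C]

/-- The pairing `d ↦ f(d₁) ⊗ g(d₂)` of two morphisms out of a comonoid `D`. -/
def pair {D Y Z : C} [ComonObj D] (f : D ⟶ Y) (g : D ⟶ Z) : D ⟶ Y ⊗ Z :=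
  Δ[D] ≫ (f ⊗ₘ g)

notation "⟪" f ", " g "⟫" => pair f g

section Pair

variable {D Y Z W V : C} [ComonObj D]

lemma pair_tensorHom (f : D ⟶ Y) (g : D ⟶ Z) (u : Y ⟶ W) (v : Z ⟶ V) :
    ⟪f, g⟫ ≫ (u ⊗ₘ v) = ⟪f ≫ u, g ≫ v⟫ := by
  simp [pair]

lemma pair_whiskerLeft (f : D ⟶ Y) (g : D ⟶ Z) (v : Z ⟶ V) :
    ⟪f, g⟫ ≫ Y ◁ v = ⟪f, g ≫ v⟫ := by
  simpa using pair_tensorHom f g (𝟙 Y) v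

lemma pair_whiskerRight (f : D ⟶ Y) (g : D ⟶ Z) (u : Y ⟶ W) :
    ⟪f, g⟫ ≫ u ▷ Z = ⟪f ≫ u, g⟫ := by
  simpa using pair_tensorHom f g u (𝟙 Z)

lemma pair_associator (f : D ⟶ Y) (g : D ⟶ Z) (k : D ⟶ W) :
    ⟪⟪f, g⟫, k⟫ ≫ (α_ Y Z W).hom = ⟪f, ⟪g, k⟫⟫ := by
  have h1 : ⟪⟪f, g⟫, k⟫ = (Δ ≫ Δ ▷ D) ≫ ((f ⊗ₘ g) ⊗ₘ k) := by
    rw [pair, pair, ← tensorHom_id, Category.assoc, tensorHom_comp_tensorHom, Category.id_comp]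
  have h2 : ⟪f, ⟪g, k⟫⟫ = (Δ ≫ D ◁ Δ) ≫ (f ⊗ₘ (g ⊗ₘ k)) := by
    rw [pair, pair, ← id_tensorHom, Category.assoc, tensorHom_comp_tensorHom, Category.id_comp]
  rw [h1, h2, comul_assoc]
  simp only [Category.assoc, associator_naturality]

lemma pair_associator_inv (f : D ⟶ Y) (g : D ⟶ Z) (k : D ⟶ W) :
    ⟪f, ⟪g, k⟫⟫ ≫ (α_ Y Z W).inv = ⟪⟪f, g⟫, k⟫ := by
  rw [Iso.comp_inv_eq, pair_associator]

-- The composition lemmas also come in a form with a further factor `k`, for use inside longer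
-- composites.
lemma pair_tensorHom_assoc (f : D ⟶ Y) (g : D ⟶ Z) (u : Y ⟶ W) (v : Z ⟶ V) {U : C}
    (k : W ⊗ V ⟶ U) : ⟪f, g⟫ ≫ (u ⊗ₘ v) ≫ k = ⟪f ≫ u, g ≫ v⟫ ≫ k := by
  rw [← Category.assoc, pair_tensorHom]

lemma pair_whiskerLeft_assoc (f : D ⟶ Y) (g : D ⟶ Z) (v : Z ⟶ V) {U : C} (k : Y ⊗ V ⟶ U) :
    ⟪f, g⟫ ≫ Y ◁ v ≫ k = ⟪f, g ≫ v⟫ ≫ k := by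
  rw [← Category.assoc, pair_whiskerLeft]

lemma pair_whiskerRight_assoc (f : D ⟶ Y) (g : D ⟶ Z) (u : Y ⟶ W) {U : C} (k : W ⊗ Z ⟶ U) :
    ⟪f, g⟫ ≫ u ▷ Z ≫ k = ⟪f ≫ u, g⟫ ≫ k := by
  rw [← Category.assoc, pair_whiskerRight]

lemma pair_associator_assoc (f : D ⟶ Y) (g : D ⟶ Z) (k : D ⟶ W) {U : C} (l : Y ⊗ Z ⊗ W ⟶ U) :
    ⟪⟪f, g⟫, k⟫ ≫ (α_ Y Z W).hom ≫ l = ⟪f, ⟪g, k⟫⟫ ≫ l := by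
  rw [← Category.assoc, pair_associator]

lemma pair_associator_inv_assoc (f : D ⟶ Y) (g : D ⟶ Z) (k : D ⟶ W) {U : C}
    (l : (Y ⊗ Z) ⊗ W ⟶ U) : ⟪f, ⟪g, k⟫⟫ ≫ (α_ Y Z W).inv ≫ l = ⟪⟪f, g⟫, k⟫ ≫ l := by
  rw [← Category.assoc, pair_associator_inv]

/-- Substitution: precomposing with a morphism of comonoids can be done factor by factor. -/
lemma comp_pair {E : C} [ComonObj E] (d : E ⟶ D) [IsComonHom d] (f : D ⟶ Y) (g : D ⟶ Z) :
    d ≫ ⟪f, g⟫ = ⟪d ≫ f, d ≫ g⟫ := by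
  simp [pair]

lemma comp_comul {E : C} [ComonObj E] (d : E ⟶ D) [IsComonHom d] : d ≫ Δ[D] = ⟪d, d⟫ := by
  simp [pair]

lemma comp_comul_assoc {E : C} [ComonObj E] (d : E ⟶ D) [IsComonHom d] {U : C}
    (k : D ⊗ D ⟶ U) : d ≫ Δ[D] ≫ k = ⟪d, d⟫ ≫ k := by
  rw [← Category.assoc, comp_comul]

lemma pair_counit_left (f : D ⟶ Y) : ⟪ε[D], f⟫ ≫ (λ_ Y).hom = f := by
  simp [pair]

lemma pair_counit_right (f : D ⟶ Y) : ⟪f, ε[D]⟫ ≫ (ρ_ Y).hom = f := by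
  simp [pair]

lemma pair_counit_left_assoc (f : D ⟶ Y) {U : C} (k : Y ⟶ U) :
    ⟪ε[D], f⟫ ≫ (λ_ Y).hom ≫ k = f ≫ k := by
  rw [← Category.assoc, pair_counit_left]

lemma pair_counit_right_assoc (f : D ⟶ Y) {U : C} (k : Y ⟶ U) :
    ⟪f, ε[D]⟫ ≫ (ρ_ Y).hom ≫ k = f ≫ k := by
  rw [← Category.assoc, pair_counit_right]

lemma comp_leftUnitor_inv (f : D ⟶ Y) : f ≫ (λ_ Y).inv = ⟪ε[D], f⟫ := by
  rw [Iso.comp_inv_eq, pair_counit_left]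

lemma comp_rightUnitor_inv (f : D ⟶ Y) : f ≫ (ρ_ Y).inv = ⟪f, ε[D]⟫ := by
  rw [Iso.comp_inv_eq, pair_counit_right]

lemma pair_counit_comp_left (u : 𝟙_ C ⟶ Y) (f : D ⟶ Z) :
    ⟪ε[D] ≫ u, f⟫ = f ≫ (λ_ Z).inv ≫ u ▷ Z := by
  rw [reassoc_of% (comp_leftUnitor_inv f), pair_whiskerRight]

lemma pair_counit_comp_right (u : 𝟙_ C ⟶ Y) (f : D ⟶ Z) :
    ⟪f, ε[D] ≫ u⟫ = f ≫ (ρ_ Z).inv ≫ Z ◁ u := by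
  rw [reassoc_of% (comp_rightUnitor_inv f), pair_whiskerLeft]

variable (Y Z) in
/-- The projection `y ⊗ z ↦ y ε(z)`. -/
def fst [ComonObj Z] : Y ⊗ Z ⟶ Y := Y ◁ ε[Z] ≫ (ρ_ Y).hom

variable (Y Z) in
/-- The projection `y ⊗ z ↦ ε(y) z`. -/
def snd [ComonObj Y] : Y ⊗ Z ⟶ Z := ε[Y] ▷ Z ≫ (λ_ Z).hom

lemma pair_fst [ComonObj Z] (f : D ⟶ Y) (g : D ⟶ Z) (hg : g ≫ ε[Z] = ε[D]) :
    ⟪f, g⟫ ≫ fst Y Z = f := by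
  rw [fst, pair_whiskerLeft_assoc, hg, pair_counit_right]

lemma pair_snd [ComonObj Y] (f : D ⟶ Y) (g : D ⟶ Z) (hf : f ≫ ε[Y] = ε[D]) :
    ⟪f, g⟫ ≫ snd Y Z = g := by
  rw [snd, pair_whiskerRight_assoc, hf, pair_counit_left]

lemma pair_fst_assoc [ComonObj Z] (f : D ⟶ Y) (g : D ⟶ Z) (hg : g ≫ ε[Z] = ε[D]) {U : C}
    (k : Y ⟶ U) : ⟪f, g⟫ ≫ fst Y Z ≫ k = f ≫ k := by
  rw [← Category.assoc, pair_fst f g hg]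

lemma pair_snd_assoc [ComonObj Y] (f : D ⟶ Y) (g : D ⟶ Z) (hf : f ≫ ε[Y] = ε[D]) {U : C}
    (k : Z ⟶ U) : ⟪f, g⟫ ≫ snd Y Z ≫ k = g ≫ k := by
  rw [← Category.assoc, pair_snd f g hf]

end Pair

section Braided

variable [SymmetricCategory C] {D Y Z W V : C} [ComonObj D]

lemma pair_counit [ComonObj Y] [ComonObj Z] (f : D ⟶ Y) (g : D ⟶ Z)
    (hf : f ≫ ε[Y] = ε[D]) (hg : g ≫ ε[Z] = ε[D]) : ⟪f, g⟫ ≫ ε[Y ⊗ Z] = ε[D] := by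
  rw [Comon.tensorObj_counit, pair_tensorHom_assoc, hf, hg, pair_counit_left]

/-- Two morphisms out of a comonoid `D` commute if `f(d₁) ⊗ g(d₂) = f(d₂) ⊗ g(d₁)`. This is no
condition if `D` is cocommutative. -/
def Commuting (f : D ⟶ Y) (g : D ⟶ Z) : Prop := ⟪f, g⟫ ≫ (β_ Y Z).hom = ⟪g, f⟫

lemma Commuting.symm {f : D ⟶ Y} {g : D ⟶ Z} (h : Commuting f g) : Commuting g f := by
  rw [Commuting, ← h]; simp

lemma Commuting.comp {f : D ⟶ Y} {g : D ⟶ Z} (h : Commuting f g) (u : Y ⟶ W) (v : Z ⟶ V) :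
    Commuting (f ≫ u) (g ≫ v) := by
  rw [Commuting, ← pair_tensorHom, ← pair_tensorHom, ← h]
  simp

lemma Commuting.comp_right {f : D ⟶ Y} {g : D ⟶ Z} (h : Commuting f g) (v : Z ⟶ V) :
    Commuting f (g ≫ v) := by
  simpa using h.comp (𝟙 _) v

lemma Commuting.comp_left {f : D ⟶ Y} {g : D ⟶ Z} (h : Commuting f g) (u : Y ⟶ W) :
    Commuting (f ≫ u) g := by
  simpa using h.comp u (𝟙 _)

lemma Commuting.precomp {E : C} [ComonObj E] (d : E ⟶ D) [IsComonHom d]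
    {f : D ⟶ Y} {g : D ⟶ Z} (h : Commuting f g) :
    Commuting (d ≫ f) (d ≫ g) := by
  rw [Commuting, ← comp_pair, ← comp_pair, ← h, Category.assoc]

lemma Commuting.pair_right {f : D ⟶ Y} {g : D ⟶ Z} {k : D ⟶ W} (h : Commuting f g)
    (h' : Commuting f k) : Commuting f ⟪g, k⟫ := by
  rw [Commuting] at *
  rw [BraidedCategory.braiding_tensor_right_hom, pair_associator_inv_assoc,
    pair_whiskerRight_assoc, h, pair_associator_assoc, pair_whiskerLeft_assoc, h',
    pair_associator_inv]

lemma Commuting.pair_left {f : D ⟶ Y} {g : D ⟶ Z} {k : D ⟶ W} (h : Commuting f k)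
    (h' : Commuting g k) : Commuting ⟪f, g⟫ k :=
  (h.symm.pair_right h'.symm).symm

lemma commuting_counit_comp (u : 𝟙_ C ⟶ Y) (f : D ⟶ Z) : Commuting (ε[D] ≫ u) f := by
  have h : Commuting ε[D] f := by
    rw [Commuting, ← comp_leftUnitor_inv, ← comp_rightUnitor_inv, Category.assoc,
      leftUnitor_inv_braiding]
  exact h.comp_left u

lemma pair_tensorμ {f : D ⟶ Y} {g : D ⟶ Z} (h : Commuting f g) (k : D ⟶ W) (l : D ⟶ V) :
    ⟪⟪k, f⟫, ⟪g, l⟫⟫ ≫ tensorμ W Y Z V = ⟪⟪k, g⟫, ⟪f, l⟫⟫ := by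
  rw [Commuting] at h
  simp only [tensorμ, pair_associator_assoc, pair_whiskerLeft_assoc, pair_associator_inv,
    pair_whiskerRight, h, pair_associator]

/-- Two commuting points form a point of the tensor product comonoid. -/
lemma isComonHom_pair [ComonObj Y] [ComonObj Z] (f : D ⟶ Y) (g : D ⟶ Z) [IsComonHom f]
    [IsComonHom g] (h : Commuting f g) : IsComonHom ⟪f, g⟫ where
  hom_counit := pair_counit f g (by simp) (by simp)
  hom_comul := by
    change _ = ⟪⟪f, g⟫, ⟪f, g⟫⟫
    rw [Comon.tensorObj_comul, pair_tensorHom_assoc, comp_comul, comp_comul, pair_tensorμ h]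

variable (Y Z) in
lemma pair_fst_snd [ComonObj Y] [ComonObj Z] : ⟪fst Y Z, snd Y Z⟫ = 𝟙 (Y ⊗ Z) := by
  have h : ((ρ_ Y).inv ⊗ₘ (λ_ Z).inv) ≫ tensorμ Y (𝟙_ C) (𝟙_ C) Z ≫
      ((ρ_ Y).hom ⊗ₘ (λ_ Z).hom) = 𝟙 (Y ⊗ Z) := by
    rw [tensorμ, braiding_tensorUnit_left]
    monoidal
  rw [← h, pair, Comon.tensorObj_comul, fst, snd, ← tensorHom_comp_tensorHom, Category.assoc,
    ← id_tensorHom, ← tensorHom_id, ← tensorμ_natural_assoc, tensorHom_comp_tensorHom_assoc]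
  simp

variable (Y Z) in
lemma pair_snd_fst [ComonObj Y] [ComonObj Z] : ⟪snd Y Z, fst Y Z⟫ = (β_ Y Z).hom := by
  have h : ((λ_ Y).inv ⊗ₘ (ρ_ Z).inv) ≫ tensorμ (𝟙_ C) Y Z (𝟙_ C) ≫
      ((λ_ Z).hom ⊗ₘ (ρ_ Y).hom) = (β_ Y Z).hom := by
    rw [tensorμ]
    monoidal
  rw [← h, pair, Comon.tensorObj_comul, fst, snd, ← tensorHom_comp_tensorHom, Category.assoc,
    ← id_tensorHom, ← tensorHom_id, ← tensorμ_natural_assoc, tensorHom_comp_tensorHom_assoc]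
  simp

variable (Y Z) in
lemma commuting_fst_snd [ComonObj Y] [ComonObj Z] : Commuting (fst Y Z) (snd Y Z) := by
  rw [Commuting, pair_fst_snd, pair_snd_fst, Category.id_comp]

instance isComonHom_fst [ComonObj Y] [ComonObj Z] : IsComonHom (fst Y Z) where
  hom_counit := by
    rw [fst, Comon.tensorObj_counit, Category.assoc, ← rightUnitor_naturality,
      MonoidalCategory.tensorHom_def', Category.assoc, unitors_equal]
  hom_comul := by
    have h : (Δ[Y] ⊗ₘ Δ[Z]) ≫ ((𝟙 Y ⊗ₘ 𝟙 Y) ⊗ₘ (ε[Z] ⊗ₘ ε[Z])) =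
        (Δ[Y] ⊗ₘ ε[Z]) ≫ (Y ⊗ Y) ◁ (λ_ (𝟙_ C)).inv := by
      rw [tensorHom_comp_tensorHom, counit_comul_hom, ← id_tensorHom, tensorHom_comp_tensorHom,
        id_tensorHom_id]
    rw [fst, Comon.tensorObj_comul, ← tensorHom_comp_tensorHom, ← id_tensorHom, Category.assoc,
      Category.assoc, ← tensorμ_natural_assoc, reassoc_of% h, ← tensor_right_unitality,
      id_tensorHom, MonoidalCategory.tensorHom_def', Category.assoc, rightUnitor_naturality]

instance isComonHom_snd [ComonObj Y] [ComonObj Z] : IsComonHom (snd Y Z) where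
  hom_counit := by
    rw [snd, Comon.tensorObj_counit, Category.assoc, ← leftUnitor_naturality,
      MonoidalCategory.tensorHom_def, Category.assoc]
  hom_comul := by
    have h : (Δ[Y] ⊗ₘ Δ[Z]) ≫ ((ε[Y] ⊗ₘ ε[Y]) ⊗ₘ (𝟙 Z ⊗ₘ 𝟙 Z)) =
        (ε[Y] ⊗ₘ Δ[Z]) ≫ (λ_ (𝟙_ C)).inv ▷ (Z ⊗ Z) := by
      rw [tensorHom_comp_tensorHom, counit_comul_hom, ← tensorHom_id, tensorHom_comp_tensorHom,
        id_tensorHom_id]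
    rw [snd, Comon.tensorObj_comul, ← tensorHom_comp_tensorHom, ← tensorHom_id, Category.assoc,
      Category.assoc, ← tensorμ_natural_assoc, reassoc_of% h, ← tensor_left_unitality,
      tensorHom_id, MonoidalCategory.tensorHom_def, Category.assoc, leftUnitor_naturality]

/-- Unlike a general morphism into `Y ⊗ Z`, a point is the pairing of its two components. -/
lemma eq_pair [ComonObj Y] [ComonObj Z] (f : D ⟶ Y ⊗ Z) [IsComonHom f] :
    f = ⟪f ≫ fst Y Z, f ≫ snd Y Z⟫ := by
  rw [← comp_pair, pair_fst_snd, Category.comp_id]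

lemma commuting_comp_fst_snd [ComonObj Y] [ComonObj Z] (f : D ⟶ Y ⊗ Z) [IsComonHom f] :
    Commuting (f ≫ fst Y Z) (f ≫ snd Y Z) :=
  (commuting_fst_snd Y Z).precomp f

/-- A morphism out of `Y ⊗ Z` is determined by its values on pairs of commuting points: the two
projections are such a pair, and their pairing is the identity. -/
lemma hom_ext_pair [ComonObj Y] [ComonObj Z] {F G : Y ⊗ Z ⟶ V}
    (h : ∀ {D : C} [ComonObj D] (y : D ⟶ Y) (z : D ⟶ Z) [IsComonHom y] [IsComonHom z],
      Commuting y z → ⟪y, z⟫ ≫ F = ⟪y, z⟫ ≫ G) : F = G := by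
  simpa [pair_fst_snd] using h (fst Y Z) (snd Y Z) (commuting_fst_snd Y Z)

lemma hom_ext_pair_right [ComonObj Y] [ComonObj Z] [ComonObj W] {F G : Y ⊗ Z ⊗ W ⟶ V}
    (h : ∀ {D : C} [ComonObj D] (y : D ⟶ Y) (z : D ⟶ Z) (w : D ⟶ W) [IsComonHom y]
      [IsComonHom z] [IsComonHom w], Commuting y z → Commuting y w → Commuting z w →
        ⟪y, ⟪z, w⟫⟫ ≫ F = ⟪y, ⟪z, w⟫⟫ ≫ G) : F = G := by
  refine hom_ext_pair fun y p _ _ c ↦ ?_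
  rw [eq_pair p]
  exact h _ _ _ (c.comp_right _) (c.comp_right _) (commuting_comp_fst_snd p)

lemma hom_ext_pair_left [ComonObj Y] [ComonObj Z] [ComonObj W] {F G : (Y ⊗ Z) ⊗ W ⟶ V}
    (h : ∀ {D : C} [ComonObj D] (y : D ⟶ Y) (z : D ⟶ Z) (w : D ⟶ W) [IsComonHom y]
      [IsComonHom z] [IsComonHom w], Commuting y z → Commuting y w → Commuting z w →
        ⟪⟪y, z⟫, w⟫ ≫ F = ⟪⟪y, z⟫, w⟫ ≫ G) : F = G := by
  refine hom_ext_pair fun p w _ _ c ↦ ?_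
  rw [eq_pair p]
  exact h _ _ _ (commuting_comp_fst_snd p) (c.comp_left _) (c.comp_left _)

/-- If `m` is undone by `m'` on commuting points, then it is undone by `m'` on every `z`, not only on
points: the universal case says that two morphisms out of `Y ⊗ Z` agree. -/
lemma cancel_left_of_pair [ComonObj Y] [ComonObj Z] {m m' : Y ⊗ Z ⟶ Z}
    (h : ∀ {D : C} [ComonObj D] (y : D ⟶ Y) (z : D ⟶ Z) [IsComonHom y] [IsComonHom z],
      Commuting y z → ⟪y, ⟪y, z⟫ ≫ m⟫ ≫ m' = z)
    (y : D ⟶ Y) [IsComonHom y] (z : D ⟶ Z) : ⟪y, ⟪y, z⟫ ≫ m⟫ ≫ m' = z := by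
  have H : Δ[Y] ▷ Z ≫ (α_ Y Y Z).hom ≫ Y ◁ m ≫ m' = ε[Y] ▷ Z ≫ (λ_ Z).hom := by
    refine hom_ext_pair fun a b _ _ c ↦ ?_
    rw [pair_whiskerRight_assoc, comp_comul, pair_associator_assoc, pair_whiskerLeft_assoc,
      h a b c, pair_whiskerRight_assoc, IsComonHom.hom_counit, pair_counit_left]
  have := ⟪y, z⟫ ≫= H
  rwa [pair_whiskerRight_assoc, comp_comul, pair_associator_assoc, pair_whiskerLeft_assoc,
    pair_whiskerRight_assoc, IsComonHom.hom_counit, pair_counit_left] at this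

/-- Mirror image of `cancel_left_of_pair`. -/
lemma cancel_right_of_pair [ComonObj Y] [ComonObj Z] {m m' : Z ⊗ Y ⟶ Z}
    (h : ∀ {D : C} [ComonObj D] (z : D ⟶ Z) (y : D ⟶ Y) [IsComonHom z] [IsComonHom y],
      Commuting z y → ⟪⟪z, y⟫ ≫ m, y⟫ ≫ m' = z)
    (y : D ⟶ Y) [IsComonHom y] (z : D ⟶ Z) : ⟪⟪z, y⟫ ≫ m, y⟫ ≫ m' = z := by
  have H : Z ◁ Δ[Y] ≫ (α_ Z Y Y).inv ≫ m ▷ Y ≫ m' = Z ◁ ε[Y] ≫ (ρ_ Z).hom := by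
    refine hom_ext_pair fun b a _ _ c ↦ ?_
    rw [pair_whiskerLeft_assoc, comp_comul, pair_associator_inv_assoc, pair_whiskerRight_assoc,
      h b a c, pair_whiskerLeft_assoc, IsComonHom.hom_counit, pair_counit_right]
  have := ⟪z, y⟫ ≫= H
  rwa [pair_whiskerLeft_assoc, comp_comul, pair_associator_inv_assoc, pair_whiskerRight_assoc,
    pair_whiskerLeft_assoc, IsComonHom.hom_counit, pair_counit_right] at this

end Braided

end Elements

/-! ### The axioms of a Hopf quasigroup in terms of generalized elements -/

section Symmetric

variable {C : Type u} [Category.{v} C] [MonoidalCategory C] [SymmetricCategory C]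

namespace HopfQuasigroup

variable (Q : HopfQuasigroup C) {D : C} [ComonObj D]

instance : IsComonHom Q.mul where
  hom_counit := Q.isHopfQuasigroup.mul_counit
  hom_comul := Q.isHopfQuasigroup.mul_comul

lemma pair_one_mul (f : D ⟶ Q.X) : ⟪ε[D] ≫ Q.one, f⟫ ≫ Q.mul = f := by
  rw [← pair_whiskerRight_assoc, Q.isHopfQuasigroup.one_mul, pair_counit_left]

lemma pair_mul_one (f : D ⟶ Q.X) : ⟪f, ε[D] ≫ Q.one⟫ ≫ Q.mul = f := by
  rw [← pair_whiskerLeft_assoc, Q.isHopfQuasigroup.mul_one, pair_counit_right]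

/-- The unit element, regarded over any comonoid `D`, is a point. -/
instance isComonHom_counit_one : IsComonHom (ε[D] ≫ Q.one) where
  hom_counit := by rw [Category.assoc, Q.isHopfQuasigroup.one_counit, Category.comp_id]
  hom_comul := by
    rw [Category.assoc, Q.isHopfQuasigroup.one_comul, reassoc_of% (comp_leftUnitor_inv ε[D]),
      pair_tensorHom, pair]

variable (h : D ⟶ Q.X) [IsComonHom h] (g : D ⟶ Q.X)

lemma antipode_mul_cancel_left : ⟪h ≫ Q.antipode, ⟪h, g⟫ ≫ Q.mul⟫ ≫ Q.mul = g := by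
  have := ⟪h, g⟫ ≫= Q.isHopfQuasigroup.antipode_mul_mul
  simpa only [pair_whiskerRight_assoc, comp_comul, pair_associator_assoc, pair_tensorHom_assoc,
    pair_counit_left, IsComonHom.hom_counit] using this

lemma mul_antipode_cancel_left : ⟪h, ⟪h ≫ Q.antipode, g⟫ ≫ Q.mul⟫ ≫ Q.mul = g := by
  have := ⟪h, g⟫ ≫= Q.isHopfQuasigroup.mul_antipode_mul
  simpa only [pair_whiskerRight_assoc, pair_whiskerLeft_assoc, pair_whiskerRight, comp_comul,
    pair_associator_assoc, pair_counit_left, IsComonHom.hom_counit] using this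

lemma antipode_mul_cancel_right : ⟪⟪g, h ≫ Q.antipode⟫ ≫ Q.mul, h⟫ ≫ Q.mul = g := by
  have := ⟪g, h⟫ ≫= Q.isHopfQuasigroup.mul_antipode_mul'
  simpa only [pair_whiskerRight_assoc, pair_whiskerLeft_assoc, pair_whiskerLeft, comp_comul,
    pair_associator_inv_assoc, pair_counit_right, IsComonHom.hom_counit] using this

lemma mul_antipode_cancel_right : ⟪⟪g, h⟫ ≫ Q.mul, h ≫ Q.antipode⟫ ≫ Q.mul = g := by
  have := ⟪g, h⟫ ≫= Q.isHopfQuasigroup.mul_mul_antipode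
  simpa only [pair_whiskerLeft_assoc, comp_comul, pair_associator_inv_assoc, pair_tensorHom_assoc,
    pair_counit_right, IsComonHom.hom_counit] using this

lemma antipode_mul_self : ⟪h ≫ Q.antipode, h⟫ ≫ Q.mul = ε[D] ≫ Q.one := by
  simpa only [pair_mul_one] using Q.antipode_mul_cancel_left h (ε[D] ≫ Q.one)

lemma mul_antipode_self : ⟪h, h ≫ Q.antipode⟫ ≫ Q.mul = ε[D] ≫ Q.one := by
  simpa only [pair_mul_one] using Q.mul_antipode_cancel_left h (ε[D] ≫ Q.one)

end HopfQuasigroup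

/-! ### Distributive laws -/

section Law

variable {A H : HopfQuasigroup C} (Ψ : H.X ⊗ A.X ⟶ A.X ⊗ H.X)

/-- Left multiplication by `A` on `A ⊗ H`: `a · (b ⊗ h) = a b ⊗ h`. -/
def leftMulA (A H : HopfQuasigroup C) : A.X ⊗ (A.X ⊗ H.X) ⟶ A.X ⊗ H.X :=
  (α_ _ _ _).inv ≫ A.mul ▷ H.X

/-- Right multiplication by `H` on `A ⊗ H`: `(a ⊗ h) · g = a ⊗ h g`. -/
def rightMulH (A H : HopfQuasigroup C) : (A.X ⊗ H.X) ⊗ H.X ⟶ A.X ⊗ H.X :=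
  (α_ _ _ _).hom ≫ A.X ◁ H.mul

/-- Left multiplication by `H` on `A ⊗ H` along `Ψ`: `h · (a ⊗ g) = Ψ(h ⊗ a) · g`. -/
def leftMulH : H.X ⊗ (A.X ⊗ H.X) ⟶ A.X ⊗ H.X :=
  (α_ _ _ _).inv ≫ Ψ ▷ H.X ≫ rightMulH A H

/-- Right multiplication by `A` on `A ⊗ H` along `Ψ`: `(b ⊗ h) · a = b · Ψ(h ⊗ a)`. -/
def rightMulA : (A.X ⊗ H.X) ⊗ A.X ⟶ A.X ⊗ H.X :=
  (α_ _ _ _).hom ≫ A.X ◁ Ψ ≫ leftMulA A H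

/-- `Ψ : H ⊗ A ⟶ A ⊗ H` is a morphism of comonoids compatible with the units and the products of `A`
and `H`. -/
structure IsDistributiveLaw : Prop where
  isComonHom : IsComonHom Ψ
  /-- `Ψ(1 ⊗ a) = a ⊗ 1` -/
  one_left : H.one ▷ A.X ≫ Ψ = (λ_ A.X).hom ≫ (ρ_ A.X).inv ≫ A.X ◁ H.one
  /-- `Ψ(h ⊗ 1) = 1 ⊗ h` -/
  one_right : H.X ◁ A.one ≫ Ψ = (ρ_ H.X).hom ≫ (λ_ H.X).inv ≫ A.one ▷ H.X
  /-- `Ψ(h ⊗ a b) = Ψ(h ⊗ a) · b` -/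
  mul_right : H.X ◁ A.mul ≫ Ψ = (α_ _ _ _).inv ≫ Ψ ▷ A.X ≫ rightMulA Ψ
  /-- `Ψ(h g ⊗ a) = h · Ψ(g ⊗ a)` -/
  mul_left : H.mul ▷ A.X ≫ Ψ = (α_ _ _ _).hom ≫ H.X ◁ Ψ ≫ leftMulH Ψ

variable {D : C} [ComonObj D]

lemma pair_leftMulA (a b : D ⟶ A.X) (h : D ⟶ H.X) :
    ⟪a, ⟪b, h⟫⟫ ≫ leftMulA A H = ⟪⟪a, b⟫ ≫ A.mul, h⟫ := by
  simp only [leftMulA, pair_associator_inv_assoc, pair_whiskerRight]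

lemma pair_rightMulH (a : D ⟶ A.X) (h g : D ⟶ H.X) :
    ⟪⟪a, h⟫, g⟫ ≫ rightMulH A H = ⟪a, ⟪h, g⟫ ≫ H.mul⟫ := by
  simp only [rightMulH, pair_associator_assoc, pair_whiskerLeft]

lemma pair_leftMulH (h : D ⟶ H.X) (a : D ⟶ A.X) (g : D ⟶ H.X) :
    ⟪h, ⟪a, g⟫⟫ ≫ leftMulH Ψ = ⟪⟪h, a⟫ ≫ Ψ, g⟫ ≫ rightMulH A H := by
  simp only [leftMulH, pair_associator_inv_assoc, pair_whiskerRight_assoc]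

lemma pair_rightMulA (b : D ⟶ A.X) (h : D ⟶ H.X) (a : D ⟶ A.X) :
    ⟪⟪b, h⟫, a⟫ ≫ rightMulA Ψ = ⟪b, ⟪h, a⟫ ≫ Ψ⟫ ≫ leftMulA A H := by
  simp only [rightMulA, pair_associator_assoc, pair_whiskerLeft_assoc]

/-- `(w · h) · S(h) = w` -/
lemma rightMulH_cancel (h : D ⟶ H.X) [IsComonHom h] (w : D ⟶ A.X ⊗ H.X) :
    ⟪⟪w, h⟫ ≫ rightMulH A H, h ≫ H.antipode⟫ ≫ rightMulH A H = w := by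
  have := cancel_right_of_pair (m := rightMulH A H) (m' := (A.X ⊗ H.X) ◁ H.antipode ≫ rightMulH A H)
    (fun z y _ _ c ↦ ?_) h w
  · rwa [pair_whiskerLeft_assoc] at this
  · rw [eq_pair z]
    simp only [pair_whiskerLeft_assoc, pair_rightMulH, H.mul_antipode_cancel_right]

/-- `S(a) · (a · w) = w` -/
lemma leftMulA_cancel (a : D ⟶ A.X) [IsComonHom a] (w : D ⟶ A.X ⊗ H.X) :
    ⟪a ≫ A.antipode, ⟪a, w⟫ ≫ leftMulA A H⟫ ≫ leftMulA A H = w := by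
  have := cancel_left_of_pair (m := leftMulA A H) (m' := A.antipode ▷ (A.X ⊗ H.X) ≫ leftMulA A H)
    (fun y z _ _ c ↦ ?_) a w
  · rwa [pair_whiskerRight_assoc] at this
  · rw [eq_pair z]
    simp only [pair_whiskerRight_assoc, pair_leftMulA, A.antipode_mul_cancel_left]

/-- `a · (S(a) · w) = w` -/
lemma leftMulA_cancel' (a : D ⟶ A.X) [IsComonHom a] (w : D ⟶ A.X ⊗ H.X) :
    ⟪a, ⟪a ≫ A.antipode, w⟫ ≫ leftMulA A H⟫ ≫ leftMulA A H = w := by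
  have := cancel_left_of_pair (m := A.antipode ▷ (A.X ⊗ H.X) ≫ leftMulA A H) (m' := leftMulA A H)
    (fun y z _ _ c ↦ ?_) a w
  · rwa [pair_whiskerRight_assoc] at this
  · rw [eq_pair z]
    simp only [pair_whiskerRight_assoc, pair_leftMulA, A.mul_antipode_cancel_left]

/-- `(w · S(h)) · h = w` -/
lemma rightMulH_cancel' (h : D ⟶ H.X) [IsComonHom h] (w : D ⟶ A.X ⊗ H.X) :
    ⟪⟪w, h ≫ H.antipode⟫ ≫ rightMulH A H, h⟫ ≫ rightMulH A H = w := by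
  have := cancel_right_of_pair (m := (A.X ⊗ H.X) ◁ H.antipode ≫ rightMulH A H) (m' := rightMulH A H)
    (fun z y _ _ c ↦ ?_) h w
  · rwa [pair_whiskerLeft_assoc] at this
  · rw [eq_pair z]
    simp only [pair_whiskerLeft_assoc, pair_rightMulH, H.antipode_mul_cancel_right]

namespace IsDistributiveLaw

variable {Ψ} (hΨ : IsDistributiveLaw Ψ)
include hΨ

lemma pair_one_left (a : D ⟶ A.X) : ⟪ε[D] ≫ H.one, a⟫ ≫ Ψ = ⟪a, ε[D] ≫ H.one⟫ := by
  rw [← pair_whiskerRight_assoc, hΨ.one_left, pair_counit_left_assoc,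
    reassoc_of% (comp_rightUnitor_inv a), pair_whiskerLeft]

lemma pair_one_right (h : D ⟶ H.X) : ⟪h, ε[D] ≫ A.one⟫ ≫ Ψ = ⟪ε[D] ≫ A.one, h⟫ := by
  rw [← pair_whiskerLeft_assoc, hΨ.one_right, pair_counit_right_assoc,
    reassoc_of% (comp_leftUnitor_inv h), pair_whiskerRight]

lemma pair_mul_right (h : D ⟶ H.X) (a b : D ⟶ A.X) :
    ⟪h, ⟪a, b⟫ ≫ A.mul⟫ ≫ Ψ = ⟪⟪h, a⟫ ≫ Ψ, b⟫ ≫ rightMulA Ψ := by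
  rw [← pair_whiskerLeft_assoc, hΨ.mul_right, pair_associator_inv_assoc, pair_whiskerRight_assoc]

lemma pair_mul_left (h g : D ⟶ H.X) (a : D ⟶ A.X) :
    ⟪⟪h, g⟫ ≫ H.mul, a⟫ ≫ Ψ = ⟪h, ⟪g, a⟫ ≫ Ψ⟫ ≫ leftMulH Ψ := by
  rw [← pair_whiskerRight_assoc, hΨ.mul_left, pair_associator_assoc, pair_whiskerLeft_assoc]

/-- On commuting points the value of `Ψ` is a pairing of points, namely of `h ▷ a` and `h ◁ a`. -/
lemma exists_pair {h : D ⟶ H.X} {a : D ⟶ A.X} [IsComonHom h] [IsComonHom a]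
    (c : Commuting h a) : ∃ (x : D ⟶ A.X) (k : D ⟶ H.X), IsComonHom x ∧ IsComonHom k ∧
      ⟪h, a⟫ ≫ Ψ = ⟪x, k⟫ := by
  have := hΨ.isComonHom
  have := isComonHom_pair h a c
  exact ⟨_, _, inferInstance, inferInstance, eq_pair (⟪h, a⟫ ≫ Ψ)⟩

/-- If `Ψ(h ⊗ a) = x ⊗ k`, then `Ψ(S(h) ⊗ x) = a ⊗ S(k)`: multiplied by `k` from the right, both
sides become `Ψ(S(h) h ⊗ a) = a ⊗ 1`, and `k` can be cancelled. -/
lemma pair_antipode_left {h : D ⟶ H.X} {a x : D ⟶ A.X} {k : D ⟶ H.X} [IsComonHom h]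
    [IsComonHom k] (e : ⟪h, a⟫ ≫ Ψ = ⟪x, k⟫) :
    ⟪h ≫ H.antipode, x⟫ ≫ Ψ = ⟪a, k ≫ H.antipode⟫ := by
  have h1 := hΨ.pair_mul_left (h ≫ H.antipode) h a
  rw [H.antipode_mul_self, hΨ.pair_one_left, e, pair_leftMulH] at h1
  rw [← rightMulH_cancel k (⟪h ≫ H.antipode, x⟫ ≫ Ψ), ← h1, pair_rightMulH, H.pair_one_mul]

/-- If `Ψ(h ⊗ a) = x ⊗ k`, then `Ψ(k ⊗ S(a)) = S(x) ⊗ h`. -/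
lemma pair_antipode_right {h : D ⟶ H.X} {a x : D ⟶ A.X} {k : D ⟶ H.X} [IsComonHom a]
    [IsComonHom x] (e : ⟪h, a⟫ ≫ Ψ = ⟪x, k⟫) :
    ⟪k, a ≫ A.antipode⟫ ≫ Ψ = ⟪x ≫ A.antipode, h⟫ := by
  have h1 := hΨ.pair_mul_right h a (a ≫ A.antipode)
  rw [A.mul_antipode_self, hΨ.pair_one_right, e, pair_rightMulA] at h1
  rw [← leftMulA_cancel x (⟪k, a ≫ A.antipode⟫ ≫ Ψ), ← h1, pair_leftMulA, A.pair_mul_one]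

/-- `S(h) · (h · w) = w` -/
lemma leftMulH_cancel (h : D ⟶ H.X) [IsComonHom h] (w : D ⟶ A.X ⊗ H.X) :
    ⟪h ≫ H.antipode, ⟪h, w⟫ ≫ leftMulH Ψ⟫ ≫ leftMulH Ψ = w := by
  have := cancel_left_of_pair (m := leftMulH Ψ) (m' := H.antipode ▷ (A.X ⊗ H.X) ≫ leftMulH Ψ)
    (fun y z _ _ c ↦ ?_) h w
  · rwa [pair_whiskerRight_assoc] at this
  · rw [eq_pair z]
    obtain ⟨x, k, _, _, e⟩ := hΨ.exists_pair (c.comp_right (fst _ _))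
    simp only [pair_whiskerRight_assoc, pair_leftMulH, e, pair_rightMulH, hΨ.pair_antipode_left e,
      H.antipode_mul_cancel_left]

/-- `(w · a) · S(a) = w` -/
lemma rightMulA_cancel (a : D ⟶ A.X) [IsComonHom a] (w : D ⟶ A.X ⊗ H.X) :
    ⟪⟪w, a⟫ ≫ rightMulA Ψ, a ≫ A.antipode⟫ ≫ rightMulA Ψ = w := by
  have := cancel_right_of_pair (m := rightMulA Ψ) (m' := (A.X ⊗ H.X) ◁ A.antipode ≫ rightMulA Ψ)
    (fun z y _ _ c ↦ ?_) a w
  · rwa [pair_whiskerLeft_assoc] at this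
  · rw [eq_pair z]
    obtain ⟨x, k, _, _, e⟩ := hΨ.exists_pair (c.comp_left (snd _ _))
    simp only [pair_whiskerLeft_assoc, pair_rightMulA, e, pair_leftMulA, hΨ.pair_antipode_right e,
      A.mul_antipode_cancel_right]

end IsDistributiveLaw

end Law

/-! ### The matched pair of a distributive law -/

section Actions

variable {A H : HopfQuasigroup C} {Ψ : H.X ⊗ A.X ⟶ A.X ⊗ H.X} {D : C} [ComonObj D]

lemma rightMulH_snd : rightMulH A H ≫ snd _ _ = snd _ _ ▷ H.X ≫ H.mul := by
  rw [rightMulH, snd, Category.assoc, whisker_exchange_assoc, leftUnitor_naturality]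
  simp

lemma leftMulA_fst : leftMulA A H ≫ fst _ _ = A.X ◁ fst _ _ ≫ A.mul := by
  rw [leftMulA, fst, Category.assoc, ← whisker_exchange_assoc, rightUnitor_naturality]
  simp

lemma rightMulH_fst : rightMulH A H ≫ fst _ _ = fst _ _ ≫ fst _ _ := by
  refine hom_ext_pair fun w g _ _ c ↦ ?_
  rw [eq_pair w, reassoc_of% (pair_rightMulH (w ≫ fst _ _) (w ≫ snd _ _) g),
    pair_fst_assoc _ _ (by simp), pair_fst, pair_fst]
  · simp
  · have := isComonHom_pair (w ≫ snd _ _) g (c.comp_left _)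
    simp

lemma leftMulA_snd : leftMulA A H ≫ snd _ _ = snd _ _ ≫ snd _ _ := by
  refine hom_ext_pair fun a w _ _ c ↦ ?_
  rw [eq_pair w, reassoc_of% (pair_leftMulA a (w ≫ fst _ _) (w ≫ snd _ _)),
    pair_snd_assoc _ _ (by simp), pair_snd, pair_snd]
  · simp
  · have := isComonHom_pair a (w ≫ fst _ _) (c.comp_right _)
    simp

lemma leftMulH_fst : leftMulH Ψ ≫ fst _ _ = H.X ◁ fst _ _ ≫ Ψ ≫ fst _ _ := by
  refine hom_ext_pair_right fun h a g _ _ _ c _ _ ↦ ?_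
  rw [reassoc_of% (pair_leftMulH Ψ h a g), rightMulH_fst, pair_fst_assoc _ _ (by simp),
    pair_whiskerLeft_assoc,
    pair_fst _ _ (by simp), Category.assoc]

lemma leftMulH_snd : leftMulH Ψ ≫ snd _ _ = (α_ _ _ _).inv ≫ (Ψ ≫ snd _ _) ▷ H.X ≫ H.mul := by
  simp [leftMulH, rightMulH_snd]

lemma rightMulA_fst : rightMulA Ψ ≫ fst _ _ = (α_ _ _ _).hom ≫ A.X ◁ (Ψ ≫ fst _ _) ≫ A.mul := by
  simp [rightMulA, leftMulA_fst]

lemma rightMulA_snd : rightMulA Ψ ≫ snd _ _ = snd _ _ ▷ A.X ≫ Ψ ≫ snd _ _ := by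
  refine hom_ext_pair_left fun b h a _ _ _ _ _ c ↦ ?_
  rw [reassoc_of% (pair_rightMulA Ψ b h a), leftMulA_snd, pair_snd_assoc _ _ (by simp),
    pair_whiskerRight_assoc,
    pair_snd _ _ (by simp), Category.assoc]

namespace IsDistributiveLaw

variable (hΨ : IsDistributiveLaw Ψ)
include hΨ

lemma mul_left_fst : H.mul ▷ A.X ≫ Ψ ≫ fst _ _ =
    (α_ _ _ _).hom ≫ H.X ◁ (Ψ ≫ fst _ _) ≫ Ψ ≫ fst _ _ := by
  rw [reassoc_of% hΨ.mul_left, leftMulH_fst, MonoidalCategory.whiskerLeft_comp_assoc]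

lemma mul_right_snd : H.X ◁ A.mul ≫ Ψ ≫ snd _ _ =
    (α_ _ _ _).inv ≫ (Ψ ≫ snd _ _) ▷ A.X ≫ Ψ ≫ snd _ _ := by
  rw [reassoc_of% hΨ.mul_right, rightMulA_snd, comp_whiskerRight_assoc]

/-- `h ▷ (S(h) ▷ a) = a`, where `h ▷ a` is the `A`-component of `Ψ(h ⊗ a)`. -/
lemma actL_antipode_cancel (h : D ⟶ H.X) [IsComonHom h] (a : D ⟶ A.X) :
    ⟪h, ⟪h ≫ H.antipode, a⟫ ≫ Ψ ≫ fst _ _⟫ ≫ Ψ ≫ fst _ _ = a := by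
  have := ⟪⟪h, h ≫ H.antipode⟫, a⟫ ≫= hΨ.mul_left_fst
  rw [pair_whiskerRight_assoc, pair_associator_assoc, pair_whiskerLeft_assoc,
    H.mul_antipode_self, reassoc_of% (hΨ.pair_one_left a), pair_fst] at this
  · exact this.symm
  · simp

/-- `(h ◁ S(a)) ◁ a = h`, where `h ◁ a` is the `H`-component of `Ψ(h ⊗ a)`. -/
lemma actR_antipode_cancel (h : D ⟶ H.X) (a : D ⟶ A.X) [IsComonHom a] :
    ⟪⟪h, a ≫ A.antipode⟫ ≫ Ψ ≫ snd _ _, a⟫ ≫ Ψ ≫ snd _ _ = h := by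
  have := ⟪h, ⟪a ≫ A.antipode, a⟫⟫ ≫= hΨ.mul_right_snd
  rw [pair_whiskerLeft_assoc, pair_associator_inv_assoc, pair_whiskerRight_assoc,
    A.antipode_mul_self, reassoc_of% (hΨ.pair_one_right h), pair_snd] at this
  · exact this.symm
  · simp

/-- For a point `h`, every `b ⊗ g` has the form `h · v`. -/
lemma exists_leftMulH_eq (h : D ⟶ H.X) [IsComonHom h] (b : D ⟶ A.X) (g : D ⟶ H.X) :
    ∃ v, ⟪h, v⟫ ≫ leftMulH Ψ = ⟪b, g⟫ := by
  have := hΨ.isComonHom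
  -- `N(h, x ⊗ g) = x ⊗ S(h ◁ x) g` satisfies `h · N(h, x ⊗ g) = (h ▷ x) ⊗ g` on points, hence
  -- universally, so that `x` may afterwards be replaced by `S(h) ▷ b`, which is not a point.
  let N : H.X ⊗ (A.X ⊗ H.X) ⟶ A.X ⊗ H.X :=
    ⟪snd _ _ ≫ fst _ _,
      ⟪⟪fst _ _, snd _ _ ≫ fst _ _⟫ ≫ Ψ ≫ snd _ _ ≫ H.antipode, snd _ _ ≫ snd _ _⟫ ≫ H.mul⟫
  have hN : Δ[H.X] ▷ _ ≫ (α_ _ _ _).hom ≫ H.X ◁ N ≫ leftMulH Ψ =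
      (α_ _ _ _).inv ≫ (Ψ ≫ fst _ _) ▷ H.X := by
    refine hom_ext_pair fun h p _ _ c ↦ ?_
    have e : ⟪h, p⟫ ≫ N = ⟪p ≫ fst _ _,
        ⟪⟪h, p ≫ fst _ _⟫ ≫ Ψ ≫ snd _ _ ≫ H.antipode, p ≫ snd _ _⟫ ≫ H.mul⟫ := by
      have := isComonHom_pair h p c
      have h1 := pair_fst h p (IsComonHom.hom_counit p)
      have h2 := pair_snd h p (IsComonHom.hom_counit h)
      simp only [N, comp_pair, ← Category.assoc, h1, h2]
    have := isComonHom_pair h (p ≫ fst _ _) (c.comp_right _)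
    rw [pair_whiskerRight_assoc, comp_comul, pair_associator_assoc, pair_whiskerLeft_assoc, e,
      pair_leftMulH, eq_pair (⟪h, p ≫ fst _ _⟫ ≫ Ψ), pair_rightMulH]
    conv_rhs => rw [eq_pair p, pair_associator_inv_assoc, pair_whiskerRight]
    have := H.mul_antipode_cancel_left ((⟪h, p ≫ fst _ _⟫ ≫ Ψ) ≫ snd _ _) (p ≫ snd _ _)
    simp only [Category.assoc] at this ⊢
    rw [this]
  refine ⟨⟪h, ⟪⟪h ≫ H.antipode, b⟫ ≫ Ψ ≫ fst _ _, g⟫⟫ ≫ N, ?_⟩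
  have := ⟪h, ⟪⟪h ≫ H.antipode, b⟫ ≫ Ψ ≫ fst _ _, g⟫⟫ ≫= hN
  rwa [pair_whiskerRight_assoc, comp_comul, pair_associator_assoc, pair_whiskerLeft_assoc,
    pair_associator_inv_assoc, pair_whiskerRight, hΨ.actL_antipode_cancel] at this

/-- For a point `a`, every `b ⊗ h` has the form `v · a`. -/
lemma exists_rightMulA_eq (a : D ⟶ A.X) [IsComonHom a] (b : D ⟶ A.X) (h : D ⟶ H.X) :
    ∃ v, ⟪v, a⟫ ≫ rightMulA Ψ = ⟪b, h⟫ := by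
  have := hΨ.isComonHom
  -- `N(b ⊗ y, a) = b S(y ▷ a) ⊗ y` satisfies `N(b ⊗ y, a) · a = b ⊗ (y ◁ a)`; then `y = h ◁ S(a)`.
  let N : (A.X ⊗ H.X) ⊗ A.X ⟶ A.X ⊗ H.X :=
    ⟪⟪fst _ _ ≫ fst _ _, ⟪fst _ _ ≫ snd _ _, snd _ _⟫ ≫ Ψ ≫ fst _ _ ≫ A.antipode⟫ ≫ A.mul,
      fst _ _ ≫ snd _ _⟫
  have hN : _ ◁ Δ[A.X] ≫ (α_ _ _ _).inv ≫ N ▷ A.X ≫ rightMulA Ψ =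
      (α_ _ _ _).hom ≫ A.X ◁ (Ψ ≫ snd _ _) := by
    refine hom_ext_pair fun p a _ _ c ↦ ?_
    have e : ⟪p, a⟫ ≫ N = ⟪⟪p ≫ fst _ _,
        ⟪p ≫ snd _ _, a⟫ ≫ Ψ ≫ fst _ _ ≫ A.antipode⟫ ≫ A.mul, p ≫ snd _ _⟫ := by
      have := isComonHom_pair p a c
      have h1 := pair_fst p a (IsComonHom.hom_counit a)
      have h2 := pair_snd p a (IsComonHom.hom_counit p)
      simp only [N, comp_pair, ← Category.assoc, h1, h2]
    have := isComonHom_pair (p ≫ snd _ _) a (c.comp_left _)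
    rw [pair_whiskerLeft_assoc, comp_comul, pair_associator_inv_assoc, pair_whiskerRight_assoc, e,
      pair_rightMulA, eq_pair (⟪p ≫ snd _ _, a⟫ ≫ Ψ), pair_leftMulA]
    conv_rhs => rw [eq_pair p, pair_associator_assoc, pair_whiskerLeft]
    have := A.antipode_mul_cancel_right ((⟪p ≫ snd _ _, a⟫ ≫ Ψ) ≫ fst _ _) (p ≫ fst _ _)
    simp only [Category.assoc] at this ⊢
    rw [this]
  refine ⟨⟪⟪b, ⟪h, a ≫ A.antipode⟫ ≫ Ψ ≫ snd _ _⟫, a⟫ ≫ N, ?_⟩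
  have := ⟪⟪b, ⟪h, a ≫ A.antipode⟫ ≫ Ψ ≫ snd _ _⟫, a⟫ ≫= hN
  rwa [pair_whiskerLeft_assoc, comp_comul, pair_associator_inv_assoc, pair_whiskerRight_assoc,
    pair_associator_assoc, pair_whiskerLeft, hΨ.actR_antipode_cancel] at this

/-- `h · (S(h) · w) = w`: write `w = h · v` and cancel `S(h)` against `h`. -/
lemma leftMulH_cancel' (h : D ⟶ H.X) [IsComonHom h] (w : D ⟶ A.X ⊗ H.X) :
    ⟪h, ⟪h ≫ H.antipode, w⟫ ≫ leftMulH Ψ⟫ ≫ leftMulH Ψ = w := by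
  have := cancel_left_of_pair (m := H.antipode ▷ (A.X ⊗ H.X) ≫ leftMulH Ψ) (m' := leftMulH Ψ)
    (fun y z _ _ c ↦ ?_) h w
  · rwa [pair_whiskerRight_assoc] at this
  · obtain ⟨v, hv⟩ := hΨ.exists_leftMulH_eq y (z ≫ fst _ _) (z ≫ snd _ _)
    rw [← eq_pair] at hv
    rw [pair_whiskerRight_assoc, ← hv, hΨ.leftMulH_cancel]

/-- `(w · S(a)) · a = w` -/
lemma rightMulA_cancel' (a : D ⟶ A.X) [IsComonHom a] (w : D ⟶ A.X ⊗ H.X) :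
    ⟪⟪w, a ≫ A.antipode⟫ ≫ rightMulA Ψ, a⟫ ≫ rightMulA Ψ = w := by
  have := cancel_right_of_pair (m := (A.X ⊗ H.X) ◁ A.antipode ≫ rightMulA Ψ) (m' := rightMulA Ψ)
    (fun z y _ _ c ↦ ?_) a w
  · rwa [pair_whiskerLeft_assoc] at this
  · obtain ⟨v, hv⟩ := hΨ.exists_rightMulA_eq y (z ≫ fst _ _) (z ≫ snd _ _)
    rw [← eq_pair] at hv
    rw [pair_whiskerLeft_assoc, ← hv, hΨ.rightMulA_cancel]

lemma crossing_eq : crossing (Ψ ≫ fst _ _) (Ψ ≫ snd _ _) = Ψ := by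
  have := hΨ.isComonHom
  exact (eq_pair Ψ).symm

/-- The matched pair of a distributive law `Ψ`: the actions are the two components of `Ψ`. The axioms
with one antipode are components of the cancellation laws for the operations on `A ⊗ H`. -/
def matchedPair : MatchedPair A H where
  actL := Ψ ≫ fst _ _
  actR := Ψ ≫ snd _ _
  one_actL := by
    rw [reassoc_of% hΨ.one_left, fst, ← MonoidalCategory.whiskerLeft_comp_assoc,
      H.isHopfQuasigroup.one_counit]
    simp
  mul_actL := by
    rw [hΨ.mul_left_fst, Iso.inv_hom_id_assoc]
  actL_counit := by
    have := hΨ.isComonHom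
    exact IsComonHom.hom_counit _
  actL_comul := by
    have := hΨ.isComonHom
    exact IsComonHom.hom_comul _
  actR_one := by
    rw [reassoc_of% hΨ.one_right, snd, ← comp_whiskerRight_assoc,
      A.isHopfQuasigroup.one_counit]
    simp
  actR_mul := by
    rw [hΨ.mul_right_snd, Iso.hom_inv_id_assoc]
  actR_counit := by
    have := hΨ.isComonHom
    exact IsComonHom.hom_counit _
  actR_comul := by
    have := hΨ.isComonHom
    exact IsComonHom.hom_comul _
  actL_one := by
    rw [reassoc_of% hΨ.one_right, fst, ← whisker_exchange_assoc, rightUnitor_naturality,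
      ← leftUnitor_inv_naturality_assoc, unitors_inv_equal, Iso.inv_hom_id_assoc]
  one_actR := by
    rw [reassoc_of% hΨ.one_left, snd, whisker_exchange_assoc, leftUnitor_naturality,
      ← rightUnitor_inv_naturality_assoc, ← unitors_inv_equal, Iso.inv_hom_id_assoc]
  act_comm := by
    have := hΨ.isComonHom
    rw [hΨ.crossing_eq]
    change ⟪Ψ ≫ snd _ _, Ψ ≫ fst _ _⟫ = _
    rw [← comp_pair, pair_snd_fst]
  actL_mul := by
    rw [hΨ.crossing_eq, comp_whiskerRight_assoc]
    congr 1
    rw [reassoc_of% hΨ.mul_right, Iso.hom_inv_id_assoc, rightMulA_fst]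
  antipode_actR := by
    rw [hΨ.crossing_eq]
    have e : H.X ◁ (α_ A.X H.X H.X).hom ≫ (α_ H.X A.X (H.X ⊗ H.X)).inv ≫
        ((Ψ ≫ snd _ _) ⊗ₘ H.mul) ≫ H.mul = H.X ◁ rightMulH A H ≫ leftMulH Ψ ≫ snd _ _ := by
      rw [leftMulH_snd, rightMulH, MonoidalCategory.tensorHom_def']
      simp
    rw [e]
    refine hom_ext_pair_right fun h a g _ _ _ _ _ _ ↦ ?_
    simp only [pair_whiskerRight_assoc, comp_comul, pair_associator_assoc, pair_whiskerLeft_assoc,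
      pair_tensorHom_assoc, pair_associator_inv, pair_whiskerRight, ← pair_leftMulH,
      reassoc_of% (hΨ.leftMulH_cancel h ⟪a, g⟫), pair_snd, IsComonHom.hom_counit, pair_counit_left]
  actR_antipode := by
    rw [hΨ.crossing_eq]
    have e : H.X ◁ (α_ A.X H.X H.X).hom ≫ (α_ H.X A.X (H.X ⊗ H.X)).inv ≫
        ((Ψ ≫ snd _ _) ⊗ₘ H.mul) ≫ H.mul = H.X ◁ rightMulH A H ≫ leftMulH Ψ ≫ snd _ _ := by
      rw [leftMulH_snd, rightMulH, MonoidalCategory.tensorHom_def']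
      simp
    rw [e]
    refine hom_ext_pair_right fun h a g _ _ _ _ _ _ ↦ ?_
    simp only [pair_whiskerRight_assoc, pair_associator_assoc, pair_whiskerLeft_assoc,
      comp_comul_assoc, pair_whiskerLeft,
      pair_tensorHom_assoc, pair_associator_inv, pair_whiskerRight, ← pair_leftMulH,
      reassoc_of% (hΨ.leftMulH_cancel' h ⟪a, g⟫), pair_snd, IsComonHom.hom_counit, pair_counit_left]
  mul_actR := by
    rw [hΨ.crossing_eq, MonoidalCategory.whiskerLeft_comp_assoc]
    congr 1
    rw [reassoc_of% hΨ.mul_left, Iso.inv_hom_id_assoc, leftMulH_snd]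
  actL_antipode := by
    rw [hΨ.crossing_eq]
    have e : (α_ A.X A.X H.X).inv ▷ A.X ≫ (α_ (A.X ⊗ A.X) H.X A.X).hom ≫
        (A.mul ⊗ₘ (Ψ ≫ fst _ _)) ≫ A.mul = leftMulA A H ▷ A.X ≫ rightMulA Ψ ≫ fst _ _ := by
      rw [rightMulA_fst, leftMulA, MonoidalCategory.tensorHom_def]
      simp
    rw [e]
    refine hom_ext_pair_left fun a h b _ _ _ _ _ _ ↦ ?_
    simp only [pair_whiskerRight_assoc, comp_comul, pair_associator, pair_whiskerLeft_assoc,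
      pair_tensorHom_assoc, pair_associator_inv_assoc, pair_whiskerLeft, ← pair_rightMulA,
      reassoc_of% (hΨ.rightMulA_cancel b ⟪a, h⟫), pair_fst, IsComonHom.hom_counit,
      pair_counit_right]
  antipode_actL := by
    rw [hΨ.crossing_eq]
    have e : (α_ A.X A.X H.X).inv ▷ A.X ≫ (α_ (A.X ⊗ A.X) H.X A.X).hom ≫
        (A.mul ⊗ₘ (Ψ ≫ fst _ _)) ≫ A.mul = leftMulA A H ▷ A.X ≫ rightMulA Ψ ≫ fst _ _ := by
      rw [rightMulA_fst, leftMulA, MonoidalCategory.tensorHom_def]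
      simp
    rw [e]
    refine hom_ext_pair_left fun a h b _ _ _ _ _ _ ↦ ?_
    simp only [pair_whiskerRight_assoc, pair_associator, pair_whiskerLeft_assoc,
      comp_comul_assoc, pair_whiskerRight,
      pair_tensorHom_assoc, pair_associator_inv_assoc, pair_whiskerLeft, ← pair_rightMulA,
      reassoc_of% (hΨ.rightMulA_cancel' b ⟪a, h⟫), pair_fst, IsComonHom.hom_counit,
      pair_counit_right]

end IsDistributiveLaw

/-! ### The distributive law of a matched pair -/

namespace MatchedPair

variable (M : MatchedPair A H)

instance : IsComonHom M.actL := ⟨M.actL_counit, M.actL_comul⟩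

instance : IsComonHom M.actR := ⟨M.actR_counit, M.actR_comul⟩

lemma commuting_act : Commuting M.actL M.actR := M.act_comm.symm

lemma pair_crossing {h : D ⟶ H.X} {a : D ⟶ A.X} [IsComonHom h] [IsComonHom a]
    (c : Commuting h a) :
    ⟪h, a⟫ ≫ crossing M.actL M.actR = ⟪⟪h, a⟫ ≫ M.actL, ⟪h, a⟫ ≫ M.actR⟫ := by
  have := isComonHom_pair h a c
  exact comp_pair _ _ _

/-- The morphism `Ψ` of a matched pair is a distributive law. Invertibility of the antipodes is what
allows `h ▷ (a b)` and `(h g) ◁ a` to be computed for all arguments. -/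
lemma isDistributiveLaw [IsIso H.antipode] [IsIso A.antipode] :
    IsDistributiveLaw (crossing M.actL M.actR) where
  isComonHom := isComonHom_pair _ _ M.commuting_act
  one_left := by
    rw [← cancel_epi (λ_ A.X).inv, ← Category.id_comp (λ_ A.X).inv, comp_leftUnitor_inv,
      pair_whiskerRight_assoc, M.pair_crossing (commuting_counit_comp _ _),
      ← pair_whiskerRight_assoc, ← pair_whiskerRight_assoc, M.one_actL, M.one_actR,
      pair_counit_left, pair_counit_left_assoc, pair_counit_left_assoc,
      reassoc_of% (comp_rightUnitor_inv (𝟙 A.X)), pair_whiskerLeft, Category.id_comp,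
      Category.id_comp]
  one_right := by
    rw [← cancel_epi (ρ_ H.X).inv, ← Category.id_comp (ρ_ H.X).inv, comp_rightUnitor_inv,
      pair_whiskerLeft_assoc, M.pair_crossing (commuting_counit_comp _ _).symm,
      ← pair_whiskerLeft_assoc, ← pair_whiskerLeft_assoc, M.actL_one, M.actR_one,
      pair_counit_right, pair_counit_right_assoc, pair_counit_right_assoc,
      reassoc_of% (comp_leftUnitor_inv (𝟙 H.X)), pair_whiskerRight, Category.id_comp,
      Category.id_comp]
  mul_right := by
    have key := M.actL_mul
    rw [comp_whiskerRight_assoc, cancel_epi] at key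
    rw [← cancel_epi (α_ _ _ _).hom, Iso.hom_inv_id_assoc]
    refine hom_ext_pair_left fun h a b _ _ _ c c' c'' ↦ ?_
    have := isComonHom_pair h a c
    have := isComonHom_pair a b c''
    have h1 := ⟪⟪h, a⟫, b⟫ ≫= key
    have h2 := ⟪⟪h, a⟫, b⟫ ≫= M.actR_mul
    simp only [pair_whiskerRight_assoc, pair_associator_assoc, pair_whiskerLeft_assoc,
      M.pair_crossing c] at h1 h2 ⊢
    rw [M.pair_crossing ((c.pair_right c').comp_right _), h1, ← h2, pair_rightMulA,
      M.pair_crossing ((c'.pair_left c'').comp_left _), pair_leftMulA]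
  mul_left := by
    have key := M.mul_actR
    rw [MonoidalCategory.whiskerLeft_comp_assoc, cancel_epi] at key
    rw [← cancel_epi (α_ _ _ _).inv, Iso.inv_hom_id_assoc]
    refine hom_ext_pair_right fun h g a _ _ _ c c' c'' ↦ ?_
    have := isComonHom_pair h g c
    have := isComonHom_pair g a c''
    have h1 := ⟪h, ⟪g, a⟫⟫ ≫= key
    have h2 := ⟪h, ⟪g, a⟫⟫ ≫= M.mul_actL
    simp only [pair_whiskerRight_assoc, pair_associator_inv_assoc, pair_whiskerLeft_assoc,
      M.pair_crossing c''] at h1 h2 ⊢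
    rw [M.pair_crossing ((c'.pair_left c'').comp_left _), h1, ← h2, pair_leftMulH,
      M.pair_crossing ((c.pair_right c').comp_right _), pair_rightMulH]

end MatchedPair

end Actions

/-! ### The double cross product -/

section DoubleCrossProduct

variable {A H : HopfQuasigroup C} {Ψ : H.X ⊗ A.X ⟶ A.X ⊗ H.X} {D : C} [ComonObj D]

/-- `(a · w) · h = a · (w · h)` -/
lemma pair_leftMulA_rightMulH (a : D ⟶ A.X) (w : D ⟶ A.X ⊗ H.X) (h : D ⟶ H.X) :
    ⟪⟪a, w⟫ ≫ leftMulA A H, h⟫ ≫ rightMulH A H = ⟪a, ⟪w, h⟫ ≫ rightMulH A H⟫ ≫ leftMulA A H := by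
  have e : leftMulA A H ▷ H.X ≫ rightMulH A H =
      (α_ _ _ _).hom ≫ A.X ◁ rightMulH A H ≫ leftMulA A H := by
    refine hom_ext_pair_left fun a w h _ _ _ _ _ _ ↦ ?_
    rw [eq_pair w]
    simp only [pair_whiskerRight_assoc, pair_associator_assoc, pair_whiskerLeft_assoc,
      pair_leftMulA, pair_rightMulH]
  rw [← pair_whiskerRight_assoc, e, pair_associator_assoc, pair_whiskerLeft_assoc]

lemma pair_one_leftMulA (w : D ⟶ A.X ⊗ H.X) : ⟪ε[D] ≫ A.one, w⟫ ≫ leftMulA A H = w := by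
  have e := pair_leftMulA (ε[A.X ⊗ H.X] ≫ A.one) (fst A.X H.X) (snd _ _)
  rw [pair_fst_snd, A.pair_one_mul, pair_fst_snd, pair_counit_comp_left, Category.id_comp] at e
  rw [pair_counit_comp_left, Category.assoc, e, Category.comp_id]

lemma pair_rightMulH_one (w : D ⟶ A.X ⊗ H.X) : ⟪w, ε[D] ≫ H.one⟫ ≫ rightMulH A H = w := by
  have e := pair_rightMulH (fst A.X H.X) (snd _ _) (ε[A.X ⊗ H.X] ≫ H.one)
  rw [pair_fst_snd, H.pair_mul_one, pair_fst_snd, pair_counit_comp_right, Category.id_comp] at e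
  rw [pair_counit_comp_right, Category.assoc, e, Category.comp_id]

variable (Ψ) in
/-- The product `(a ⊗ h)(b ⊗ g) = a · (Ψ(h ⊗ b) · g)` on `A ⊗ H`. -/
def crossedMul : (A.X ⊗ H.X) ⊗ (A.X ⊗ H.X) ⟶ A.X ⊗ H.X :=
  (α_ _ _ _).hom ≫ A.X ◁ leftMulH Ψ ≫ leftMulA A H

variable (Ψ) in
/-- The structure morphisms which a morphism `Ψ : H ⊗ A ⟶ A ⊗ H` defines on the comonoid
`A ⊗ H`. -/
abbrev crossedProduct : HopfQuasigroupData C where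
  X := A.X ⊗ H.X
  one := (λ_ (𝟙_ C)).inv ≫ (A.one ⊗ₘ H.one)
  mul := crossedMul Ψ
  antipode := (β_ A.X H.X).hom ≫ (H.antipode ⊗ₘ A.antipode) ≫ Ψ

lemma MatchedPair.doubleCrossProduct_eq (M : MatchedPair A H) :
    M.doubleCrossProduct = crossedProduct (crossing M.actL M.actR) := by
  have : (α_ A.X H.X (A.X ⊗ H.X)).hom ≫ A.X ◁ (α_ H.X A.X H.X).inv ≫
    A.X ◁ (crossing M.actL M.actR ▷ H.X) ≫ A.X ◁ (α_ A.X H.X H.X).hom ≫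
    (α_ A.X A.X (H.X ⊗ H.X)).inv ≫ (A.mul ⊗ₘ H.mul) = crossedMul (crossing M.actL M.actR) := by
    rw [crossedMul, leftMulH, rightMulH, leftMulA, MonoidalCategory.tensorHom_def']
    simp
  rw [doubleCrossProduct, crossedProduct, this]

/-- `(a ⊗ h) w = a · (h · w)` -/
lemma pair_crossedMul_left (a : D ⟶ A.X) (h : D ⟶ H.X) (w : D ⟶ A.X ⊗ H.X) :
    ⟪⟪a, h⟫, w⟫ ≫ crossedMul Ψ = ⟪a, ⟪h, w⟫ ≫ leftMulH Ψ⟫ ≫ leftMulA A H := by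
  rw [crossedMul, pair_associator_assoc, pair_whiskerLeft_assoc]

/-- `w (a ⊗ h) = (w · a) · h` -/
lemma pair_crossedMul_right (w : D ⟶ A.X ⊗ H.X) (a : D ⟶ A.X) (h : D ⟶ H.X) :
    ⟪w, ⟪a, h⟫⟫ ≫ crossedMul Ψ = ⟪⟪w, a⟫ ≫ rightMulA Ψ, h⟫ ≫ rightMulH A H := by
  have e : crossedMul Ψ = (α_ _ _ _).inv ≫ rightMulA Ψ ▷ H.X ≫ rightMulH A H := by
    refine hom_ext_pair fun p q _ _ _ ↦ ?_
    rw [eq_pair p, eq_pair q, pair_crossedMul_left, pair_associator_inv_assoc,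
      pair_whiskerRight_assoc, pair_rightMulA, pair_leftMulH, pair_leftMulA_rightMulH]
  rw [e, pair_associator_inv_assoc, pair_whiskerRight_assoc]

variable (Ψ) in
/-- On a point the antipode is `a ⊗ h ↦ Ψ(S(h) ⊗ S(a))`, since its components commute. -/
lemma comp_crossedAntipode (p : D ⟶ A.X ⊗ H.X) [IsComonHom p] :
    p ≫ (crossedProduct Ψ).antipode =
      ⟪(p ≫ snd _ _) ≫ H.antipode, (p ≫ fst _ _) ≫ A.antipode⟫ ≫ Ψ := by
  rw [← pair_tensorHom_assoc, ← commuting_comp_fst_snd p, ← eq_pair, Category.assoc]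

variable (Ψ) in
lemma counit_crossedOne : ε[D] ≫ (crossedProduct Ψ).one = ⟪ε[D] ≫ A.one, ε[D] ≫ H.one⟫ := by
  rw [reassoc_of% (comp_leftUnitor_inv ε[D]), pair_tensorHom]

variable (Ψ) in
lemma isComonHom_crossedOne :
    letI := instTensorUnit C
    IsComonHom (crossedProduct Ψ).one := by
  let := instTensorUnit C
  have hA : IsComonHom A.one := ⟨A.isHopfQuasigroup.one_counit, A.isHopfQuasigroup.one_comul⟩
  have hH : IsComonHom H.one := ⟨H.isHopfQuasigroup.one_counit, H.isHopfQuasigroup.one_comul⟩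
  refine isComonHom_pair A.one H.one ?_
  simpa using commuting_counit_comp A.one H.one

namespace IsDistributiveLaw

variable (hΨ : IsDistributiveLaw Ψ)
include hΨ

lemma pair_one_leftMulH (w : D ⟶ A.X ⊗ H.X) : ⟪ε[D] ≫ H.one, w⟫ ≫ leftMulH Ψ = w := by
  have e := pair_leftMulH Ψ (ε[A.X ⊗ H.X] ≫ H.one) (fst A.X H.X) (snd _ _)
  rw [pair_fst_snd, hΨ.pair_one_left, pair_rightMulH, H.pair_one_mul, pair_fst_snd,
    pair_counit_comp_left, Category.id_comp] at e
  rw [pair_counit_comp_left, Category.assoc, e, Category.comp_id]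

lemma pair_rightMulA_one (w : D ⟶ A.X ⊗ H.X) : ⟪w, ε[D] ≫ A.one⟫ ≫ rightMulA Ψ = w := by
  have e := pair_rightMulA Ψ (fst A.X H.X) (snd _ _) (ε[A.X ⊗ H.X] ≫ A.one)
  rw [pair_fst_snd, hΨ.pair_one_right, pair_leftMulA, A.pair_mul_one, pair_fst_snd,
    pair_counit_comp_right, Category.id_comp] at e
  rw [pair_counit_comp_right, Category.assoc, e, Category.comp_id]

/-- `Ψ(h ⊗ a) w = h · (a · w)` -/
lemma pair_crossing_crossedMul (h : D ⟶ H.X) (a : D ⟶ A.X) (w : D ⟶ A.X ⊗ H.X) :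
    ⟪⟪h, a⟫ ≫ Ψ, w⟫ ≫ crossedMul Ψ = ⟪h, ⟪a, w⟫ ≫ leftMulA A H⟫ ≫ leftMulH Ψ := by
  have e : Ψ ▷ _ ≫ crossedMul Ψ = (α_ _ _ _).hom ≫ H.X ◁ leftMulA A H ≫ leftMulH Ψ := by
    refine hom_ext_pair_left fun h a w _ _ _ _ _ _ ↦ ?_
    rw [eq_pair w, pair_whiskerRight_assoc, pair_crossedMul_right, ← hΨ.pair_mul_right,
      pair_associator_assoc, pair_whiskerLeft_assoc, pair_leftMulA, pair_leftMulH]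
  rw [← pair_whiskerRight_assoc, e, pair_associator_assoc, pair_whiskerLeft_assoc]

/-- `w Ψ(h ⊗ a) = (w · h) · a` -/
lemma pair_crossedMul_crossing (w : D ⟶ A.X ⊗ H.X) (h : D ⟶ H.X) (a : D ⟶ A.X) :
    ⟪w, ⟪h, a⟫ ≫ Ψ⟫ ≫ crossedMul Ψ = ⟪⟪w, h⟫ ≫ rightMulH A H, a⟫ ≫ rightMulA Ψ := by
  have e : _ ◁ Ψ ≫ crossedMul Ψ = (α_ _ _ _).inv ≫ rightMulH A H ▷ A.X ≫ rightMulA Ψ := by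
    refine hom_ext_pair_right fun w h a _ _ _ _ _ _ ↦ ?_
    rw [eq_pair w, pair_whiskerLeft_assoc, pair_crossedMul_left, ← hΨ.pair_mul_left,
      pair_associator_inv_assoc, pair_whiskerRight_assoc, pair_rightMulH, pair_rightMulA]
  rw [← pair_whiskerLeft_assoc, e, pair_associator_inv_assoc, pair_whiskerRight_assoc]

lemma isComonHom_crossedMul : IsComonHom (crossedMul Ψ) := by
  have key : ∀ {D : C} [ComonObj D] (p q : D ⟶ A.X ⊗ H.X) [IsComonHom p] [IsComonHom q],
      Commuting p q → IsComonHom (⟪p, q⟫ ≫ crossedMul Ψ) := by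
    intro D _ p q _ _ c
    have := hΨ.isComonHom
    obtain ⟨a, h, _, _, c', rfl⟩ : ∃ (a : D ⟶ A.X) (h : D ⟶ H.X), IsComonHom a ∧ IsComonHom h ∧
        Commuting a h ∧ p = ⟪a, h⟫ :=
      ⟨_, _, inferInstance, inferInstance, commuting_comp_fst_snd p, eq_pair p⟩
    obtain ⟨b, g, _, _, c'', rfl⟩ : ∃ (a : D ⟶ A.X) (h : D ⟶ H.X), IsComonHom a ∧ IsComonHom h ∧
        Commuting a h ∧ q = ⟪a, h⟫ :=
      ⟨_, _, inferInstance, inferInstance, commuting_comp_fst_snd q, eq_pair q⟩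
    have ha : ⟪a, h⟫ ≫ fst _ _ = a := pair_fst _ _ (by simp)
    have hh : ⟪a, h⟫ ≫ snd _ _ = h := pair_snd _ _ (by simp)
    have hb : ⟪b, g⟫ ≫ fst _ _ = b := pair_fst _ _ (by simp)
    have hg : ⟪b, g⟫ ≫ snd _ _ = g := pair_snd _ _ (by simp)
    have cab : Commuting a b := by simpa only [ha, hb] using c.comp (fst _ _) (fst _ _)
    have cag : Commuting a g := by simpa only [ha, hg] using c.comp (fst _ _) (snd _ _)
    have chb : Commuting h b := by simpa only [hh, hb] using c.comp (snd _ _) (fst _ _)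
    have chg : Commuting h g := by simpa only [hh, hg] using c.comp (snd _ _) (snd _ _)
    have := isComonHom_pair h b chb
    have cx : Commuting a (⟪h, b⟫ ≫ Ψ) := (c'.pair_right cab).comp_right _
    have cy : Commuting (⟪h, b⟫ ≫ Ψ) g := (chg.pair_left c'').comp_left _
    rw [pair_crossedMul_left, pair_leftMulH, eq_pair (⟪h, b⟫ ≫ Ψ), pair_rightMulH, pair_leftMulA]
    have := isComonHom_pair _ _ (cx.comp_right (fst _ _))
    have := isComonHom_pair _ _ (cy.comp_left (snd _ _))
    refine isComonHom_pair _ _ (((Commuting.pair_right ?_ cag).pair_left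
      (Commuting.pair_right ?_ ?_)).comp A.mul H.mul)
    · exact cx.comp_right _
    · exact commuting_comp_fst_snd _
    · exact cy.comp_left _
  simpa only [pair_fst_snd, Category.id_comp] using key _ _ (commuting_fst_snd _ _)

/-- The double cross product is a Hopf quasigroup. Multiplication by `d = a ⊗ h` is multiplication by
`h` and by `a` in turn, and multiplication by the antipode of `d` is multiplication by `S(a)` and
`S(h)` in the opposite order, so the antipode axioms reduce to the cancellation laws for `A` and
`H`. -/
theorem isHopfQuasigroup : (crossedProduct Ψ).IsHopfQuasigroup where
  one_mul := by
    rw [← cancel_epi (λ_ _).inv, ← Category.id_comp (λ_ _).inv, Category.assoc,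
      ← reassoc_of% (pair_counit_comp_left (crossedProduct Ψ).one (𝟙 (A.X ⊗ H.X))),
      counit_crossedOne Ψ, pair_crossedMul_left, hΨ.pair_one_leftMulH, pair_one_leftMulA]
    simp
  mul_one := by
    rw [← cancel_epi (ρ_ _).inv, ← Category.id_comp (ρ_ _).inv, Category.assoc,
      ← reassoc_of% (pair_counit_comp_right (crossedProduct Ψ).one (𝟙 (A.X ⊗ H.X))),
      counit_crossedOne Ψ, pair_crossedMul_right, hΨ.pair_rightMulA_one, pair_rightMulH_one]
    simp
  one_counit :=
    letI := instTensorUnit C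
    (isComonHom_crossedOne Ψ).hom_counit
  one_comul :=
    letI := instTensorUnit C
    (isComonHom_crossedOne Ψ).hom_comul
  mul_counit := hΨ.isComonHom_crossedMul.hom_counit
  mul_comul := hΨ.isComonHom_crossedMul.hom_comul
  antipode_mul_mul := by
    refine hom_ext_pair fun p w _ _ _ ↦ ?_
    rw [pair_whiskerRight_assoc, comp_comul, pair_associator_assoc, pair_tensorHom_assoc,
      comp_crossedAntipode, hΨ.pair_crossing_crossedMul]
    conv_lhs => enter [1, 2, 1, 2, 1, 1]; rw [eq_pair p]
    rw [pair_crossedMul_left, leftMulA_cancel, hΨ.leftMulH_cancel, pair_whiskerRight_assoc,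
      IsComonHom.hom_counit, pair_counit_left]
  mul_antipode_mul := by
    refine hom_ext_pair fun p w _ _ _ ↦ ?_
    rw [pair_whiskerRight_assoc, comp_comul, pair_associator_assoc, pair_whiskerLeft_assoc,
      pair_whiskerRight, pair_whiskerLeft_assoc,
      comp_crossedAntipode, hΨ.pair_crossing_crossedMul]
    conv_lhs => enter [1, 1]; rw [eq_pair p]
    rw [pair_crossedMul_left, hΨ.leftMulH_cancel', leftMulA_cancel', pair_whiskerRight_assoc,
      IsComonHom.hom_counit, pair_counit_left]
  mul_antipode_mul' := by
    refine hom_ext_pair fun w p _ _ _ ↦ ?_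
    rw [pair_whiskerLeft_assoc, comp_comul, pair_associator_inv_assoc, pair_whiskerRight_assoc,
      pair_whiskerLeft, pair_whiskerRight_assoc,
      comp_crossedAntipode, hΨ.pair_crossedMul_crossing]
    conv_lhs => enter [1, 2]; rw [eq_pair p]
    rw [pair_crossedMul_right, hΨ.rightMulA_cancel', rightMulH_cancel', pair_whiskerLeft_assoc,
      IsComonHom.hom_counit, pair_counit_right]
  mul_mul_antipode := by
    refine hom_ext_pair fun w p _ _ _ ↦ ?_
    rw [pair_whiskerLeft_assoc, comp_comul, pair_associator_inv_assoc, pair_tensorHom_assoc,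
      comp_crossedAntipode, hΨ.pair_crossedMul_crossing]
    conv_lhs => enter [1, 1, 1, 1, 1, 2]; rw [eq_pair p]
    rw [pair_crossedMul_right, rightMulH_cancel, hΨ.rightMulA_cancel, pair_whiskerLeft_assoc,
      IsComonHom.hom_counit, pair_counit_right]

end IsDistributiveLaw

end DoubleCrossProduct

end Symmetric

/-! ### Morphisms of Hopf quasigroups and transport of factorizations -/

section Hom

variable {C : Type u} [Category.{v} C] [MonoidalCategory C]

namespace HopfQuasigroupData.IsHom

variable {P Q : HopfQuasigroupData C}

lemma isComonHom {f : P.X ⟶ Q.X} (hf : IsHom f) : IsComonHom f := ⟨hf.map_counit, hf.map_comul⟩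

lemma pair_mul {f : P.X ⟶ Q.X} (hf : IsHom f) {D : C} [ComonObj D] (x y : D ⟶ P.X) :
    (⟪x, y⟫ ≫ P.mul) ≫ f = ⟪x ≫ f, y ≫ f⟫ ≫ Q.mul := by
  rw [Category.assoc, hf.map_mul, pair_tensorHom_assoc]

lemma counit_one {f : P.X ⟶ Q.X} (hf : IsHom f) {D : C} [ComonObj D] :
    (ε[D] ≫ P.one) ≫ f = ε[D] ≫ Q.one := by
  rw [Category.assoc, hf.map_one]

lemma inv (e : P.X ≅ Q.X) (he : IsHom e.hom) : IsHom e.inv where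
  map_one := by rw [Iso.comp_inv_eq, he.map_one]
  map_mul := by
    rw [Iso.comp_inv_eq, Category.assoc, he.map_mul, tensorHom_comp_tensorHom_assoc]
    simp
  map_counit := by rw [Iso.inv_comp_eq, he.map_counit]
  map_comul := by
    rw [Iso.inv_comp_eq, reassoc_of% he.map_comul, tensorHom_comp_tensorHom]
    simp

lemma comp {R : HopfQuasigroupData C} {f : P.X ⟶ Q.X} {g : Q.X ⟶ R.X} (hf : IsHom f)
    (hg : IsHom g) : IsHom (P := P) (Q := R) (f ≫ g) where
  map_one := by rw [reassoc_of% hf.map_one, hg.map_one]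
  map_mul := by
    rw [reassoc_of% hf.map_mul, hg.map_mul, tensorHom_comp_tensorHom_assoc]
  map_counit := by rw [Category.assoc, hg.map_counit, hf.map_counit]
  map_comul := by
    rw [Category.assoc, hg.map_comul, reassoc_of% hf.map_comul, tensorHom_comp_tensorHom]

end HopfQuasigroupData.IsHom

variable [SymmetricCategory C] {A H X Y : HopfQuasigroup C}

open HopfQuasigroupData (IsHom)

lemma IsFactorization.of_iso {iA : A.X ⟶ Y.X} {iH : H.X ⟶ Y.X} (F : IsFactorization iA iH)
    (e : Y.X ≅ X.X)
    (he : IsHom (P := Y.toHopfQuasigroupData) (Q := X.toHopfQuasigroupData) e.hom) :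
    IsFactorization (iA ≫ e.hom) (iH ≫ e.hom) := by
  have hm : X.mul = (e.inv ⊗ₘ e.inv) ≫ Y.mul ≫ e.hom := by
    rw [he.map_mul, tensorHom_comp_tensorHom_assoc]
    simp
  have := F.mono_A
  have := F.mono_H
  have := F.isIso
  have hω : ((iA ≫ e.hom) ⊗ₘ (iH ≫ e.hom)) ≫ X.mul = ((iA ⊗ₘ iH) ≫ Y.mul) ≫ e.hom := by
    rw [Category.assoc, he.map_mul, tensorHom_comp_tensorHom_assoc]
  refine
    { isHom_A := F.isHom_A.comp he
      isHom_H := F.isHom_H.comp he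
      mono_A := inferInstance
      mono_H := inferInstance
      isIso := hω ▸ inferInstance
      mul_assoc_left := hom_ext_pair_left fun a h x _ _ _ _ _ _ ↦ ?_
      mul_assoc_right := hom_ext_pair_right fun x a h _ _ _ _ _ _ ↦ ?_
      antipode_assoc_left := hom_ext_pair_left fun h a x _ _ _ _ _ _ ↦ ?_
      antipode_assoc_right := hom_ext_pair_right fun x h a _ _ _ _ _ _ ↦ ?_ }
  · have := (⟪⟪a, h⟫, x ≫ e.inv⟫ ≫= F.mul_assoc_left) =≫ e.hom
    rw [hm]
    simpa [pair_whiskerRight_assoc, pair_associator_assoc, pair_tensorHom_assoc] using this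
  · have := (⟪x ≫ e.inv, ⟪a, h⟫⟫ ≫= F.mul_assoc_right) =≫ e.hom
    rw [hm]
    simpa [pair_whiskerLeft_assoc, pair_associator_inv_assoc, pair_tensorHom_assoc] using this
  · have := (⟪⟪h, a⟫, x ≫ e.inv⟫ ≫= F.antipode_assoc_left) =≫ e.hom
    rw [hm]
    simpa [pair_whiskerRight_assoc, pair_associator_assoc, pair_tensorHom_assoc] using this
  · have := (⟪x ≫ e.inv, ⟪h, a⟫⟫ ≫= F.antipode_assoc_right) =≫ e.hom
    rw [hm]
    simpa [pair_whiskerLeft_assoc, pair_associator_inv_assoc, pair_tensorHom_assoc] using this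

/-! ### The double cross product factorizes -/

section CrossedProduct

variable {Ψ : H.X ⊗ A.X ⟶ A.X ⊗ H.X} {D : C} [ComonObj D]

/-- The inclusion `a ↦ a ⊗ 1`. -/
def inclA (A H : HopfQuasigroup C) : A.X ⟶ A.X ⊗ H.X := (ρ_ A.X).inv ≫ A.X ◁ H.one

/-- The inclusion `h ↦ 1 ⊗ h`. -/
def inclH (A H : HopfQuasigroup C) : H.X ⟶ A.X ⊗ H.X := (λ_ H.X).inv ≫ A.one ▷ H.X

lemma comp_inclA (a : D ⟶ A.X) : a ≫ inclA A H = ⟪a, ε[D] ≫ H.one⟫ :=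
  (pair_counit_comp_right _ _).symm

lemma comp_inclH (h : D ⟶ H.X) : h ≫ inclH A H = ⟪ε[D] ≫ A.one, h⟫ :=
  (pair_counit_comp_left _ _).symm

instance : IsComonHom (inclA A H) := by
  rw [← Category.id_comp (inclA A H), comp_inclA]
  exact isComonHom_pair _ _ (commuting_counit_comp _ _).symm

instance : IsComonHom (inclH A H) := by
  rw [← Category.id_comp (inclH A H), comp_inclH]
  exact isComonHom_pair _ _ (commuting_counit_comp _ _)

lemma pair_inclH_crossedMul (h : D ⟶ H.X) (w : D ⟶ A.X ⊗ H.X) :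
    ⟪h ≫ inclH A H, w⟫ ≫ crossedMul Ψ = ⟪h, w⟫ ≫ leftMulH Ψ := by
  rw [comp_inclH, pair_crossedMul_left, pair_one_leftMulA]

lemma pair_crossedMul_inclA (w : D ⟶ A.X ⊗ H.X) (a : D ⟶ A.X) :
    ⟪w, a ≫ inclA A H⟫ ≫ crossedMul Ψ = ⟪w, a⟫ ≫ rightMulA Ψ := by
  rw [comp_inclA, pair_crossedMul_right, pair_rightMulH_one]

lemma inclH_inclA_crossedMul : (inclH A H ⊗ₘ inclA A H) ≫ crossedMul Ψ = Ψ := by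
  refine hom_ext_pair fun h a _ _ _ ↦ ?_
  rw [pair_tensorHom_assoc, pair_inclH_crossedMul, comp_inclA, pair_leftMulH,
    pair_rightMulH_one]

namespace IsDistributiveLaw

variable (hΨ : IsDistributiveLaw Ψ)
include hΨ

lemma pair_inclA_crossedMul (a : D ⟶ A.X) (w : D ⟶ A.X ⊗ H.X) :
    ⟪a ≫ inclA A H, w⟫ ≫ crossedMul Ψ = ⟪a, w⟫ ≫ leftMulA A H := by
  rw [comp_inclA, pair_crossedMul_left, hΨ.pair_one_leftMulH]

lemma pair_crossedMul_inclH (w : D ⟶ A.X ⊗ H.X) (h : D ⟶ H.X) :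
    ⟪w, h ≫ inclH A H⟫ ≫ crossedMul Ψ = ⟪w, h⟫ ≫ rightMulH A H := by
  rw [comp_inclH, pair_crossedMul_right, hΨ.pair_rightMulA_one]

lemma inclA_inclH_crossedMul : (inclA A H ⊗ₘ inclH A H) ≫ crossedMul Ψ = 𝟙 _ := by
  refine hom_ext_pair fun a h _ _ _ ↦ ?_
  rw [pair_tensorHom_assoc, hΨ.pair_inclA_crossedMul, comp_inclH, pair_leftMulA, A.pair_mul_one,
    Category.comp_id]

/-- The inclusions exhibit `A ⋈ H` as a product of `A` and `H`: here `ω` is the identity and `θ` is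
`Ψ`. -/
lemma isFactorization : IsFactorization (A := A) (H := H)
    (X := ⟨crossedProduct Ψ, hΨ.isHopfQuasigroup⟩) (inclA A H) (inclH A H) where
  isHom_A :=
    { map_one := by
        change A.one ≫ inclA A H = (λ_ (𝟙_ C)).inv ≫ (A.one ⊗ₘ H.one)
        rw [inclA, rightUnitor_inv_naturality_assoc, ← MonoidalCategory.tensorHom_def,
          unitors_inv_equal]
      map_mul := hom_ext_pair fun a b _ _ _ ↦ by
        rw [pair_tensorHom_assoc, hΨ.pair_inclA_crossedMul, comp_inclA b, pair_leftMulA,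
          ← Category.assoc, comp_inclA (⟪a, b⟫ ≫ A.mul)]
      map_counit := IsComonHom.hom_counit _
      map_comul := IsComonHom.hom_comul _ }
  isHom_H :=
    { map_one := by
        change H.one ≫ inclH A H = (λ_ (𝟙_ C)).inv ≫ (A.one ⊗ₘ H.one)
        rw [inclH, leftUnitor_inv_naturality_assoc, ← MonoidalCategory.tensorHom_def']
      map_mul := hom_ext_pair fun a b _ _ _ ↦ by
        rw [pair_tensorHom_assoc, hΨ.pair_crossedMul_inclH, comp_inclH a, pair_rightMulH,
          ← Category.assoc, comp_inclH (⟪a, b⟫ ≫ H.mul)]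
      map_counit := IsComonHom.hom_counit _
      map_comul := IsComonHom.hom_comul _ }
  mono_A := by
    have h : inclA A H ≫ fst _ _ = 𝟙 _ := by
      rw [← Category.id_comp (inclA A H), comp_inclA, pair_fst _ _ (by simp)]
    exact mono_of_mono_fac h
  mono_H := by
    have h : inclH A H ≫ snd _ _ = 𝟙 _ := by
      rw [← Category.id_comp (inclH A H), comp_inclH, pair_snd _ _ (by simp)]
    exact mono_of_mono_fac h
  isIso := by
    change IsIso ((inclA A H ⊗ₘ inclH A H) ≫ crossedMul Ψ)
    rw [hΨ.inclA_inclH_crossedMul]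
    infer_instance
  mul_assoc_left := by
    change ((inclA A H ⊗ₘ inclH A H) ≫ crossedMul Ψ) ▷ (A.X ⊗ H.X) ≫ crossedMul Ψ =
      _ ≫ (inclA A H ⊗ₘ (inclH A H ▷ (A.X ⊗ H.X) ≫ crossedMul Ψ)) ≫ crossedMul Ψ
    rw [hΨ.inclA_inclH_crossedMul]
    refine hom_ext_pair_left fun a h w _ _ _ _ _ _ ↦ ?_
    simp only [pair_associator_assoc, pair_tensorHom_assoc, hΨ.pair_inclA_crossedMul,
      pair_whiskerRight_assoc, pair_inclH_crossedMul, Category.comp_id, pair_crossedMul_left]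
  mul_assoc_right := by
    change (A.X ⊗ H.X) ◁ ((inclA A H ⊗ₘ inclH A H) ≫ crossedMul Ψ) ≫ crossedMul Ψ =
      _ ≫ (((A.X ⊗ H.X) ◁ inclA A H ≫ crossedMul Ψ) ⊗ₘ inclH A H) ≫ crossedMul Ψ
    rw [hΨ.inclA_inclH_crossedMul]
    refine hom_ext_pair_right fun w a h _ _ _ _ _ _ ↦ ?_
    simp only [pair_associator_inv_assoc, pair_tensorHom_assoc, hΨ.pair_crossedMul_inclH,
      pair_whiskerLeft_assoc, pair_crossedMul_inclA, Category.comp_id, pair_crossedMul_right]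
  antipode_assoc_left := by
    change ((_ ⊗ₘ _) ≫ (inclH A H ⊗ₘ inclA A H) ≫ crossedMul Ψ) ▷ (A.X ⊗ H.X) ≫ crossedMul Ψ =
      _ ≫ (_ ⊗ₘ (_ ▷ (A.X ⊗ H.X) ≫ crossedMul Ψ)) ≫ crossedMul Ψ
    rw [inclH_inclA_crossedMul]
    refine hom_ext_pair_left fun h a w _ _ _ _ _ _ ↦ ?_
    simp only [pair_associator_assoc, pair_tensorHom_assoc, pair_whiskerRight_assoc]
    rw [← Category.assoc h, pair_inclH_crossedMul, ← Category.assoc a,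
      hΨ.pair_inclA_crossedMul, hΨ.pair_crossing_crossedMul]
  antipode_assoc_right := by
    change (A.X ⊗ H.X) ◁ ((_ ⊗ₘ _) ≫ (inclH A H ⊗ₘ inclA A H) ≫ crossedMul Ψ) ≫ crossedMul Ψ =
      _ ≫ (((A.X ⊗ H.X) ◁ _ ≫ crossedMul Ψ) ⊗ₘ _) ≫ crossedMul Ψ
    rw [inclH_inclA_crossedMul]
    refine hom_ext_pair_right fun w h a _ _ _ _ _ _ ↦ ?_
    simp only [pair_associator_inv_assoc, pair_tensorHom_assoc, pair_whiskerLeft_assoc]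
    rw [← Category.assoc a, pair_crossedMul_inclA, ← Category.assoc h,
      hΨ.pair_crossedMul_inclH, hΨ.pair_crossedMul_crossing]

end IsDistributiveLaw

end CrossedProduct

/-! ### The distributive law of a factorization -/

section Factorization

variable {iA : A.X ⟶ X.X} {iH : H.X ⟶ X.X}

instance isComonHom_tensorHom {Y Z V W : C} [ComonObj Y] [ComonObj Z] [ComonObj V] [ComonObj W]
    (f : Y ⟶ V) (g : Z ⟶ W) [IsComonHom f] [IsComonHom g] : IsComonHom (f ⊗ₘ g) := by
  have : f ⊗ₘ g = ⟪fst Y Z ≫ f, snd Y Z ≫ g⟫ := by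
    rw [← pair_tensorHom, pair_fst_snd, Category.id_comp]
  rw [this]
  exact isComonHom_pair _ _ ((commuting_fst_snd Y Z).comp f g)

namespace IsFactorization

variable (F : IsFactorization iA iH) {D : C} [ComonObj D]

variable (iA iH) in
/-- The morphism `ω : a ⊗ h ↦ a h`. -/
abbrev prodAH : A.X ⊗ H.X ⟶ X.X := (iA ⊗ₘ iH) ≫ X.mul

variable (iA iH) in
/-- The morphism `θ : h ⊗ a ↦ h a`. -/
abbrev prodHA : H.X ⊗ A.X ⟶ X.X := (iH ⊗ₘ iA) ≫ X.mul

variable (iA iH) in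
/-- The morphism `Ψ` which rewrites `h a` in the form `a' h'`, that is, `Ψ ≫ ω = θ`. -/
noncomputable def twist [IsIso (prodAH iA iH)] : H.X ⊗ A.X ⟶ A.X ⊗ H.X :=
  prodHA iA iH ≫ inv (prodAH iA iH)

include F

lemma pair_AH_mul (a : D ⟶ A.X) (h : D ⟶ H.X) (x : D ⟶ X.X) :
    ⟪⟪a ≫ iA, h ≫ iH⟫ ≫ X.mul, x⟫ ≫ X.mul = ⟪a ≫ iA, ⟪h ≫ iH, x⟫ ≫ X.mul⟫ ≫ X.mul := by
  simpa only [pair_whiskerRight_assoc, pair_associator_assoc, pair_tensorHom_assoc] using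
    ⟪⟪a, h⟫, x⟫ ≫= F.mul_assoc_left

lemma pair_mul_AH (x : D ⟶ X.X) (a : D ⟶ A.X) (h : D ⟶ H.X) :
    ⟪x, ⟪a ≫ iA, h ≫ iH⟫ ≫ X.mul⟫ ≫ X.mul = ⟪⟪x, a ≫ iA⟫ ≫ X.mul, h ≫ iH⟫ ≫ X.mul := by
  simpa only [pair_whiskerLeft_assoc, pair_associator_inv_assoc, pair_tensorHom_assoc] using
    ⟪x, ⟪a, h⟫⟫ ≫= F.mul_assoc_right

/-- `(h a) x = h (a x)`, for all `h` and `a` because the antipodes are invertible. -/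
lemma pair_HA_mul [IsIso H.antipode] [IsIso A.antipode] (h : D ⟶ H.X) (a : D ⟶ A.X)
    (x : D ⟶ X.X) :
    ⟪⟪h ≫ iH, a ≫ iA⟫ ≫ X.mul, x⟫ ≫ X.mul = ⟪h ≫ iH, ⟪a ≫ iA, x⟫ ≫ X.mul⟫ ≫ X.mul := by
  simpa [pair_whiskerRight_assoc, pair_associator_assoc, pair_tensorHom_assoc] using
    ⟪⟪h ≫ inv H.antipode, a ≫ inv A.antipode⟫, x⟫ ≫= F.antipode_assoc_left

/-- `x (h a) = (x h) a`, for all `h` and `a` because the antipodes are invertible. -/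
lemma pair_mul_HA [IsIso H.antipode] [IsIso A.antipode] (x : D ⟶ X.X) (h : D ⟶ H.X)
    (a : D ⟶ A.X) :
    ⟪x, ⟪h ≫ iH, a ≫ iA⟫ ≫ X.mul⟫ ≫ X.mul = ⟪⟪x, h ≫ iH⟫ ≫ X.mul, a ≫ iA⟫ ≫ X.mul := by
  simpa [pair_whiskerLeft_assoc, pair_associator_inv_assoc, pair_tensorHom_assoc] using
    ⟪x, ⟪h ≫ inv H.antipode, a ≫ inv A.antipode⟫⟫ ≫= F.antipode_assoc_right

-- Under `ω` the four operations on `A ⊗ H` become multiplication in `X`.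
lemma leftMulA_prodAH : leftMulA A H ≫ prodAH iA iH = (iA ⊗ₘ prodAH iA iH) ≫ X.mul := by
  refine hom_ext_pair_right fun a b h _ _ _ _ _ _ ↦ ?_
  rw [reassoc_of% (pair_leftMulA a b h), pair_tensorHom_assoc, pair_tensorHom_assoc,
    pair_tensorHom_assoc,
    F.isHom_A.pair_mul, F.pair_mul_AH]

lemma rightMulH_prodAH : rightMulH A H ≫ prodAH iA iH = (prodAH iA iH ⊗ₘ iH) ≫ X.mul := by
  refine hom_ext_pair_left fun a h g _ _ _ _ _ _ ↦ ?_
  rw [reassoc_of% (pair_rightMulH a h g), pair_tensorHom_assoc, pair_tensorHom_assoc,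
    pair_tensorHom_assoc,
    F.isHom_H.pair_mul, F.pair_AH_mul]

lemma isComonHom_prodAH : IsComonHom (prodAH iA iH) := by
  have := F.isHom_A.isComonHom
  have := F.isHom_H.isComonHom
  infer_instance

variable [IsIso (prodAH iA iH)]

omit F in
lemma twist_prodAH : twist iA iH ≫ prodAH iA iH = prodHA iA iH := by
  rw [twist, Category.assoc, IsIso.inv_hom_id, Category.comp_id]

lemma leftMulH_prodAH :
    leftMulH (twist iA iH) ≫ prodAH iA iH = (iH ⊗ₘ prodAH iA iH) ≫ X.mul := by
  refine hom_ext_pair_right fun h a g _ _ _ _ _ _ ↦ ?_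
  rw [reassoc_of% (pair_leftMulH (twist iA iH) h a g), F.rightMulH_prodAH,
    pair_tensorHom_assoc, Category.assoc,
    twist_prodAH, pair_tensorHom_assoc, pair_tensorHom_assoc, pair_tensorHom_assoc,
    F.pair_mul_AH]

lemma rightMulA_prodAH :
    rightMulA (twist iA iH) ≫ prodAH iA iH = (prodAH iA iH ⊗ₘ iA) ≫ X.mul := by
  refine hom_ext_pair_left fun b h a _ _ _ _ _ _ ↦ ?_
  rw [reassoc_of% (pair_rightMulA (twist iA iH) b h a), F.leftMulA_prodAH,
    pair_tensorHom_assoc, Category.assoc,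
    twist_prodAH, pair_tensorHom_assoc, pair_tensorHom_assoc, pair_tensorHom_assoc,
    F.pair_AH_mul]

/-- The compatibilities of `Ψ` with the products become, after composition with `ω`, the associativity
laws `h (a b) = (h a) b` and `(h g) a = h (g a)` in `X`. -/
theorem isDistributiveLaw [IsIso H.antipode] [IsIso A.antipode] :
    IsDistributiveLaw (twist iA iH) where
  isComonHom := by
    have := F.isHom_A.isComonHom
    have := F.isHom_H.isComonHom
    have := F.isComonHom_prodAH
    rw [twist]
    infer_instance
  one_left := by
    rw [← cancel_mono (prodAH iA iH), Category.assoc, twist_prodAH, ← cancel_epi (λ_ _).inv,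
      Category.assoc, Category.assoc, Iso.inv_hom_id_assoc, ← Category.id_comp (λ_ _).inv,
      Category.assoc, ← reassoc_of% (pair_counit_comp_left H.one (𝟙 A.X)),
      ← Category.id_comp ((ρ_ _).inv ≫ _),
      ← reassoc_of% (pair_counit_comp_right H.one (𝟙 A.X)), pair_tensorHom_assoc,
      pair_tensorHom_assoc, F.isHom_H.counit_one, X.pair_one_mul, X.pair_mul_one]
  one_right := by
    rw [← cancel_mono (prodAH iA iH), Category.assoc, twist_prodAH, ← cancel_epi (ρ_ _).inv,
      Category.assoc, Category.assoc, Iso.inv_hom_id_assoc, ← Category.id_comp (ρ_ _).inv,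
      Category.assoc, ← reassoc_of% (pair_counit_comp_right A.one (𝟙 H.X)),
      ← Category.id_comp ((λ_ _).inv ≫ _),
      ← reassoc_of% (pair_counit_comp_left A.one (𝟙 H.X)), pair_tensorHom_assoc,
      pair_tensorHom_assoc, F.isHom_A.counit_one, X.pair_one_mul, X.pair_mul_one]
  mul_right := by
    rw [← cancel_mono (prodAH iA iH)]
    refine hom_ext_pair_right fun h a b _ _ _ _ _ _ ↦ ?_
    simp only [Category.assoc, F.rightMulA_prodAH, twist_prodAH, pair_whiskerLeft_assoc,
      pair_tensorHom_assoc, pair_associator_inv_assoc, pair_whiskerRight_assoc]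
    rw [← Category.assoc ⟪a, b⟫, F.isHom_A.pair_mul, F.pair_HA_mul]
  mul_left := by
    rw [← cancel_mono (prodAH iA iH)]
    refine hom_ext_pair_left fun h g a _ _ _ _ _ _ ↦ ?_
    simp only [Category.assoc, F.leftMulH_prodAH, twist_prodAH, pair_whiskerLeft_assoc,
      pair_tensorHom_assoc, pair_associator_assoc, pair_whiskerRight_assoc]
    rw [← Category.assoc ⟪h, g⟫, F.isHom_H.pair_mul, F.pair_mul_HA]

/-- `ω` is multiplicative: `(a · (h · w)) ↦ a (h ω(w)) = (a h) ω(w)`. -/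
lemma isHom_prodAH :
    IsHom (P := crossedProduct (twist iA iH)) (Q := X.toHopfQuasigroupData) (prodAH iA iH) where
  map_one := by
    have h := MonoidalCategory.tensorHom_def' X.one X.one =≫ X.mul
    rw [Category.assoc, X.isHopfQuasigroup.one_mul, leftUnitor_naturality] at h
    rw [Category.assoc, tensorHom_comp_tensorHom_assoc, F.isHom_A.map_one, F.isHom_H.map_one, h,
      Iso.inv_hom_id_assoc]
  map_mul := by
    change crossedMul _ ≫ _ = _
    refine hom_ext_pair fun p w _ _ _ ↦ ?_
    rw [eq_pair p,
      reassoc_of% (pair_crossedMul_left (Ψ := twist iA iH) (p ≫ fst _ _) (p ≫ snd _ _) w),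
      F.leftMulA_prodAH, pair_tensorHom_assoc,
      Category.assoc ⟪p ≫ snd _ _, w⟫, F.leftMulH_prodAH, pair_tensorHom_assoc,
      pair_tensorHom_assoc, pair_tensorHom_assoc, F.pair_AH_mul]
  map_counit := F.isComonHom_prodAH.hom_counit
  map_comul := F.isComonHom_prodAH.hom_comul

end IsFactorization

end Factorization

end Hom

theorem mainTheorem1 {C : Type u} [Category.{v} C] [MonoidalCategory C] [SymmetricCategory C]
    (H A X : HopfQuasigroup C) (hH : IsIso H.antipode) (hA : IsIso A.antipode) :
    (∀ M : MatchedPair A H, M.doubleCrossProduct.IsHopfQuasigroup) ∧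
    (Factorizes X A H ↔
      ∃ (M : MatchedPair A H) (e : X.X ≅ M.doubleCrossProduct.X),
        HopfQuasigroupData.IsHom (P := X.toHopfQuasigroupData) (Q := M.doubleCrossProduct)
          e.hom) := by
  refine ⟨fun M ↦ ?_, ?_, ?_⟩
  · rw [M.doubleCrossProduct_eq]
    exact M.isDistributiveLaw.isHopfQuasigroup
  · rintro ⟨iA, iH, F⟩
    have := F.isIso
    have hΨ := F.isDistributiveLaw
    have e : hΨ.matchedPair.doubleCrossProduct = crossedProduct (IsFactorization.twist iA iH) := by
      rw [MatchedPair.doubleCrossProduct_eq]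
      exact congrArg crossedProduct hΨ.crossing_eq
    refine ⟨hΨ.matchedPair, ?_⟩
    rw [e]
    let ω : (crossedProduct (IsFactorization.twist iA iH)).X ≅ X.X :=
      asIso (IsFactorization.prodAH iA iH)
    exact ⟨ω.symm, HopfQuasigroupData.IsHom.inv ω F.isHom_prodAH⟩
  · rintro ⟨M, h⟩
    rw [M.doubleCrossProduct_eq] at h
    obtain ⟨e, he⟩ := h
    exact ⟨_, _, M.isDistributiveLaw.isFactorization.of_iso e.symm
      (HopfQuasigroupData.IsHom.inv e he)⟩
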